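/- Let $\mathbb R^3_1$ be $\mathbb R^3$ with coordinates $(t,x,y)$ and the inner product $\langle\,,\rangle=-dt^2+dx^2+dy^2$. A real analytic curve $\gamma:I\to\mathbb R^3_1$ on a nonempty open interval $I$ is called a non-degenerate null curve if, for all $s\in I$, $\gamma'(s)\neq 0$, $\langle\gamma'(s),\gamma'(s)\rangle=0$, and $\gamma''(s)$ is not a multiple of $\gamma'(s)$. Such a curve extends to a holomorphic map (again denoted $\gamma$) into $\mathbb C^3$ on an open neighbourhood of $I$ in $\mathbb C$; near $I$ the extension is unique. Set $$\hat\phi_\gamma(u,v)=\begin{cases}\frac12\bigl(\gamma(u+i\sqrt v)+\gamma(u-i\sqrt v)\bigr)&(v\ge 0),\\[2pt] \frac12\bigl(\gamma(u+\sqrt{|v|})+\gamma(u-\sqrt{|v|})\bigr)&(v<0).\end{cases}$$ For a $C^\infty$ function $f$ on a domain $\Omega\subset\mathbb R^2$, consider the zero mean curvature equation $$(1-f_y^2)f_{xx}+2f_xf_yf_{xy}+(1-f_x^2)f_{yy}=0,\qquad(\ast)$$ and put $B=1-f_x^2-f_y^2$. If $f$ satisfies $(\ast)$, a point $p\in\Omega$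 is a non-degenerate point of type change with respect to $f$ if $B(p)=0$ and $\nabla B(p)\ne 0$. An immersion $\phi(u,v)$ into $\mathbb R^3_1$ is a zero mean curvature immersion if $EN-2FM+GL=0$, where $E,F,G$ are the coefficients of its first fundamental form and $L,M,N$ those of its second fundamental form with respect to the normal field $\nu$ given by $\langle X,\nu\rangle=\det(X,\phi_u,\phi_v)$ (where $EG-F^2\neq0$, this says that the mean curvature vanishes; for a graph $t=f(x,y)$ it is $(\ast)$). **Theorem.** (1) Let $\gamma:I\to\mathbb R^3_1$ be a real analytic non-degenerate null curve. Then there is an open neighbourhood $W$ of $I\times\{0\}$ in $\mathbb R^2$ on which $\hat\phi_\gamma$ is well defined, takes values in $\mathbb R^3_1$, and is a real analytic zero mean curvature immersion. Moreover, for each $u\in I$, $\hat\phi_\gamma(u,0)=\gamma(u)$, and this is a non-degenerate point of type change of $\hat\phi_\gamma$: there are an open neighbourhood $V\subset W$ of $(u,0)$ and a real analytic solution $f$ of $(\ast)$ on a domain $\Omega\subset\mathbb R^2$ such that $\hat\phi_\gamma(V)$ is the graph $\{(f(x,y),x,y):(x,y)\in\Omega\}$ and the projection of $\gamma(u)$ to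 the $xy$-plane is a non-degenerate point of type change with respect to $f$. (2) Conversely, let $f$ be a $C^\infty$ solution of $(\ast)$ on a domain $\Omega\subset\mathbb R^2$ and let $p=(x_0,y_0)\in\Omega$ be a non-degenerate point of type change with respect to $f$. Then there are a real analytic non-degenerate null curve $\gamma:I\to\mathbb R^3_1$ and $u_0\in I$ with $\gamma(u_0)=(f(x_0,y_0),x_0,y_0)$, an open neighbourhood $V$ of $(u_0,0)$ on which $\hat\phi_\gamma$ is defined and real valued, and an open neighbourhood $\Omega'\subset\Omega$ of $p$, such that $\hat\phi_\gamma(V)$ is the graph $\{(f(x,y),x,y):(x,y)\in\Omega'\}$ of $f$ over $\Omega'$. -/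

import Mathlib

open scoped ContDiff

noncomputable section

namespace TypeChange

/-- Lorentz-Minkowski `3`-space `ℝ³₁`, with coordinates `(t, x, y)` indexed by `0, 1, 2`. -/
abbrev Mink := Fin 3 → ℝ

/-- The Lorentzian inner product of signature `(-,+,+)`. -/
def lorentz (v w : Mink) : ℝ := -(v 0 * w 0) + v 1 * w 1 + v 2 * w 2

/-- A light-like vector. -/
def IsLightlike (v : Mink) : Prop := v ≠ 0 ∧ lorentz v v = 0

/-- The Lorentzian cross product, characterised by `⟨X, a × b⟩ = det (X, a, b)`. -/
def lorentzCross (a b : Mink) : Mink :=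
  ![-(a 1 * b 2 - a 2 * b 1), a 2 * b 0 - a 0 * b 2, a 0 * b 1 - a 1 * b 0]

/-! ### Null curves and their holomorphic extensions -/

/-- `γ`, restricted to the nonempty open interval `I` (bounded or not), is a real analytic
non-degenerate null curve: the velocity is light-like (in particular non-zero) and the
acceleration is nowhere proportional to the velocity. -/
structure IsNondegenerateNullCurve (I : Set ℝ) (γ : ℝ → Mink) : Prop where
  isOpen : IsOpen I
  ordConnected : I.OrdConnected
  nonempty : I.Nonempty
  analytic : AnalyticOnNhd ℝ γ I
  null : ∀ t ∈ I, IsLightlike (deriv γ t)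
  nondegenerate : ∀ t ∈ I, ¬ ∃ k : ℝ, deriv (deriv γ) t = k • deriv γ t

/-- `Γ` is a holomorphic extension of the curve `γ : I → ℝ³` to the open set `U ⊆ ℂ`,
`I ⊆ U`, with values in `ℂ³`. -/
structure IsHolomorphicExtension (I : Set ℝ) (γ : ℝ → Mink)
    (U : Set ℂ) (Γ : ℂ → Fin 3 → ℂ) : Prop where
  isOpen : IsOpen U
  subset : ∀ t ∈ I, (t : ℂ) ∈ U
  holomorphic : DifferentiableOn ℂ Γ U
  agree : ∀ t ∈ I, ∀ j, Γ (t : ℂ) j = (γ t j : ℂ)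

/-- The formula for `φ̂_γ(u, v)`, as a vector of `ℂ³`; `Γ` is the holomorphic extension of `γ`. -/
def phiHatC (Γ : ℂ → Fin 3 → ℂ) (q : ℝ × ℝ) : Fin 3 → ℂ :=
  if 0 ≤ q.2 then
    (2⁻¹ : ℂ) • (Γ (q.1 + Complex.I * (√q.2 : ℝ)) + Γ (q.1 - Complex.I * (√q.2 : ℝ)))
  else
    (2⁻¹ : ℂ) • (Γ ((q.1 + √|q.2| : ℝ) : ℂ) + Γ ((q.1 - √|q.2| : ℝ) : ℂ))

/-- `φ̂_γ` as a map to `ℝ³₁`. -/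
def phiHat (Γ : ℂ → Fin 3 → ℂ) (q : ℝ × ℝ) : Mink := fun j => (phiHatC Γ q j).re

/-- The points `(u, v)` at which the formula for `φ̂_γ` is meaningful for the curve
`γ` on `I` and its extension to `U`. -/
def phiHatDomain (I : Set ℝ) (U : Set ℂ) : Set (ℝ × ℝ) :=
  {q | (0 ≤ q.2 → (q.1 + Complex.I * (√q.2 : ℝ) : ℂ) ∈ U ∧
          (q.1 - Complex.I * (√q.2 : ℝ) : ℂ) ∈ U) ∧
       (q.2 < 0 → q.1 + √|q.2| ∈ I ∧ q.1 - √|q.2| ∈ I)}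

/-! ### Zero mean curvature -/

/-- Partial derivative with respect to the first variable. -/
def d₁ {E : Type*} [NormedAddCommGroup E] [NormedSpace ℝ E] (g : ℝ × ℝ → E) (q : ℝ × ℝ) : E :=
  fderiv ℝ g q (1, 0)

/-- Partial derivative with respect to the second variable. -/
def d₂ {E : Type*} [NormedAddCommGroup E] [NormedSpace ℝ E] (g : ℝ × ℝ → E) (q : ℝ × ℝ) : E :=
  fderiv ℝ g q (0, 1)

/-- The normal direction `φ_u × φ_v` (not normalised, so that it also makes sense at
light-like points). -/
def normal (φ : ℝ × ℝ → Mink) (q : ℝ × ℝ) : Mink := lorentzCross (d₁ φ q) (d₂ φ q)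

/-- `E N - 2 F M + G L`, where `E, F, G` is the first fundamental form and `L, M, N` is the second
fundamental form with respect to the normal `ν = φ_u × φ_v`. Where `EG - F² ≠ 0`, the mean
curvature is, up to sign, this divided by `2 (EG - F²) |⟨ν,ν⟩|^(1/2)`, and
`|⟨ν,ν⟩| = |EG - F²|`. For a graph `(x, y) ↦ (f(x,y), x, y)` it is
`(1 - f_y²) f_xx + 2 f_x f_y f_xy + (1 - f_x²) f_yy`. -/
def meanCurvatureNumerator (φ : ℝ × ℝ → Mink) (q : ℝ × ℝ) : ℝ :=
  lorentz (d₁ φ q) (d₁ φ q) * lorentz (d₂ (d₂ φ) q) (normal φ q)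
    - 2 * lorentz (d₁ φ q) (d₂ φ q) * lorentz (d₂ (d₁ φ) q) (normal φ q)
    + lorentz (d₂ φ q) (d₂ φ q) * lorentz (d₁ (d₁ φ) q) (normal φ q)

/-- `φ` is a real analytic zero mean curvature immersion of the open set `W` into `ℝ³₁`
(of possibly varying causal type). -/
structure IsAnalyticZMCImmersion (W : Set (ℝ × ℝ)) (φ : ℝ × ℝ → Mink) : Prop where
  isOpen : IsOpen W
  analytic : AnalyticOnNhd ℝ φ W
  immersion : ∀ q ∈ W, Function.Injective (fderiv ℝ φ q)
  zero_mean_curvature : ∀ q ∈ W, meanCurvatureNumerator φ q = 0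

/-- `f` is a `C^∞` solution of the zero mean curvature equation on the domain `Ω`. -/
structure IsZMCSolution (Ω : Set (ℝ × ℝ)) (f : ℝ × ℝ → ℝ) : Prop where
  isOpen : IsOpen Ω
  isConnected : IsConnected Ω
  smooth : ContDiffOn ℝ ∞ f Ω
  equation : ∀ q ∈ Ω,
    (1 - d₂ f q ^ 2) * d₁ (d₁ f) q + 2 * d₁ f q * d₂ f q * d₂ (d₁ f) q
      + (1 - d₁ f q ^ 2) * d₂ (d₂ f) q = 0

/-- The function `B = 1 - f_x² - f_y²`. -/
def typeFun (f : ℝ × ℝ → ℝ) (q : ℝ × ℝ) : ℝ := 1 - d₁ f q ^ 2 - d₂ f q ^ 2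

/-- `p` is a non-degenerate point of type change with respect to `f`: `B(p) = 0`, `∇B(p) ≠ 0`. -/
def IsNondegenerateTypeChange (f : ℝ × ℝ → ℝ) (p : ℝ × ℝ) : Prop :=
  typeFun f p = 0 ∧ (d₁ (typeFun f) p, d₂ (typeFun f) p) ≠ ((0, 0) : ℝ × ℝ)

/-- The graph `t = f(x, y)` over `Ω`, as a subset of `ℝ³₁`. -/
def graphOver (f : ℝ × ℝ → ℝ) (Ω : Set (ℝ × ℝ)) : Set Mink :=
  (fun p : ℝ × ℝ => ![f p, p.1, p.2]) '' Ω

/-- The point `φ q₀` of the surface `φ : W → ℝ³₁` is a non-degenerate point of type change: near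
`q₀` the surface is the graph of a real analytic solution `f` of the zero mean curvature
equation, and the projection of `φ q₀` to the `xy`-plane is a non-degenerate point of type
change with respect to `f`. -/
def IsNondegenerateTypeChangeOfSurface (W : Set (ℝ × ℝ)) (φ : ℝ × ℝ → Mink) (q₀ : ℝ × ℝ) : Prop :=
  ∃ V ⊆ W, IsOpen V ∧ q₀ ∈ V ∧ ∃ (Ω : Set (ℝ × ℝ)) (f : ℝ × ℝ → ℝ),
    IsZMCSolution Ω f ∧ AnalyticOnNhd ℝ f Ω ∧ φ '' V = graphOver f Ω ∧
    IsNondegenerateTypeChange f (φ q₀ 1, φ q₀ 2)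

end TypeChange

end

/-!
Near `v = 0` the averages of `γ` along `u ± i√v` and `u ± √|v|` are one analytic function of
`(u, v)`, the even part of `γ` being a function of the square of the increment. On `v = -s² < 0` the
surface `φ̂ = ½ (γ(u + s) + γ(u - s))` is half the sum of two null curves, so it solves the wave
equation in the isothermal parameters `(u, s)`, which forces zero mean curvature; rewritten in
`(u, v)` these relations are analytic and extend across `v = 0`. For the graph function they give
`(∗)` and `J² B = 4 v ⟨φ̂_v, φ̂_v⟩²`, with `J` the Jacobian of the projection of `φ̂` to the
`xy`-plane, so `B` vanishes to first order along `γ`.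

Conversely, at a non-degenerate point of type change the gradient of `f` is a local diffeomorphism.
In polar coordinates of the gradient plane, with radius `sech τ` on the spacelike side and `sec τ`
on the timelike side, the inverse surface solves the Laplace equation on the one side and the wave
equation on the other, with vanishing normal derivative along `τ = 0`. It is therefore the real part
of a holomorphic curve and the d'Alembert average of its boundary curve `γ` respectively; both are
the two branches of `φ̂_γ`.
-/

namespace TypeChange

open Filter Topology Complex

section EvenPart

variable {𝕜 : Type*} [NontriviallyNormedField 𝕜]

theorem hasFPowerSeriesOnBall_ofScalarsSum (A : Type*) [NormedRing A] [NormedAlgebra 𝕜 A]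
    [NormOneClass A] [CompleteSpace A] {f : 𝕜 → 𝕜} {p : FormalMultilinearSeries 𝕜 𝕜 𝕜} {z₀ : 𝕜}
    {R : ENNReal} (hf : HasFPowerSeriesOnBall f p z₀ R) :
    HasFPowerSeriesOnBall (FormalMultilinearSeries.ofScalarsSum p.coeff : A → A)
      (FormalMultilinearSeries.ofScalars A p.coeff) 0 R := by
  have hradius : (FormalMultilinearSeries.ofScalars A p.coeff).radius = p.radius := by
    simp only [FormalMultilinearSeries.radius, FormalMultilinearSeries.ofScalars_norm,
      FormalMultilinearSeries.norm_apply_eq_norm_coef]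
  have hR : R ≤ (FormalMultilinearSeries.ofScalars A p.coeff).radius := hradius ▸ hf.r_le
  exact (FormalMultilinearSeries.hasFPowerSeriesOnBall _ (hf.r_pos.trans_le hR)).mono hf.r_pos hR

theorem ofScalarsSum_apply_of_apply_eq_smul {E : Type*} [NormedAddCommGroup E] [NormedSpace 𝕜 E]
    [CompleteSpace E] {f : 𝕜 → 𝕜} {p : FormalMultilinearSeries 𝕜 𝕜 𝕜} {z₀ : 𝕜}
    {R : ENNReal} (hf : HasFPowerSeriesOnBall f p z₀ R) {T : E →L[𝕜] E} (hT : ‖T‖ₑ < R)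
    {x : E} {c : 𝕜} (hx : T x = c • x) :
    FormalMultilinearSeries.ofScalarsSum p.coeff T x = f (z₀ + c) • x := by
  rcases eq_or_ne x 0 with rfl | hx0
  · simp
  have : Nontrivial E := ⟨x, 0, hx0⟩
  have hpow (n : ℕ) : (T ^ n) x = c ^ n • x := by
    induction n with
    | zero => simp
    | succ n ih => rw [pow_succ', mul_apply_eq_comp, ih, map_smul, hx, smul_smul, pow_succ]
  have hc : ‖c‖ₑ < R := by
    refine lt_of_le_of_lt (enorm_le_iff_norm_le.2 ?_) hT
    have h := T.le_opNorm x
    rw [hx, norm_smul] at h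
    exact le_of_mul_le_mul_right h (norm_pos_iff.2 hx0)
  have hsumT := ((hasFPowerSeriesOnBall_ofScalarsSum (E →L[𝕜] E) hf).hasSum (y := T)
    (by simpa using hT)).mapL (ContinuousLinearMap.apply 𝕜 E x)
  have hsumc := (hf.hasSum (y := c) (by simpa using hc)).smul_const x
  rw [zero_add] at hsumT
  refine hsumT.unique ?_
  convert hsumc using 2 with n
  simp [FormalMultilinearSeries.ofScalars_apply_eq, hpow, smul_smul, mul_comm]

/-- The operator `(x, y) ↦ (h x + ε⁻¹ v y, ε x + h y)` on `𝕜²`, for `q = (h, v)`. It depends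
polynomially on `q` although its eigenvalues `h ± √v` do not; the scale `ε` makes its norm small
near `q = 0`. -/
def sqrtOp (ε : 𝕜) (q : 𝕜 × 𝕜) : 𝕜 × 𝕜 →L[𝕜] 𝕜 × 𝕜 :=
  q.1 • ContinuousLinearMap.id 𝕜 (𝕜 × 𝕜) +
    q.2 • ε⁻¹ • (ContinuousLinearMap.inl 𝕜 𝕜 𝕜).comp (ContinuousLinearMap.snd 𝕜 𝕜 𝕜) +
    ε • (ContinuousLinearMap.inr 𝕜 𝕜 𝕜).comp (ContinuousLinearMap.fst 𝕜 𝕜 𝕜)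

theorem sqrtOp_apply_eigenvector {ε : 𝕜} (hε : ε ≠ 0) {q : 𝕜 × 𝕜} {s : 𝕜} (hs : s ^ 2 = q.2) :
    sqrtOp ε q (s, ε) = (q.1 + s) • (s, ε) := by
  ext
  · simp [sqrtOp, ← hs, hε]
    ring
  · simp [sqrtOp]
    ring

theorem analyticAt_sqrtOp (ε : 𝕜) (q : 𝕜 × 𝕜) : AnalyticAt 𝕜 (sqrtOp ε) q :=
  ((analyticAt_fst.smul analyticAt_const).add (analyticAt_snd.smul analyticAt_const)).add
    analyticAt_const

theorem norm_sqrtOp_zero_le (ε : 𝕜) : ‖sqrtOp ε (0 : 𝕜 × 𝕜)‖ ≤ ‖ε‖ := by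
  refine ContinuousLinearMap.opNorm_le_bound _ (norm_nonneg ε) fun x => ?_
  have happly : sqrtOp ε (0 : 𝕜 × 𝕜) x = (0, ε * x.1) := by ext <;> simp [sqrtOp]
  rw [happly, Prod.norm_mk, norm_zero, max_eq_right (norm_nonneg _), norm_mul]
  gcongr
  exact norm_fst_le x

theorem exists_enorm_sqrtOp_zero_lt {R : ENNReal} (hR : 0 < R) :
    ∃ ε : 𝕜, ε ≠ 0 ∧ ‖sqrtOp ε (0 : 𝕜 × 𝕜)‖ₑ < R := by
  obtain ⟨r, hr, hrR⟩ := ENNReal.lt_iff_exists_nnreal_btwn.1 hR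
  obtain ⟨ε, hε, hεr⟩ := NormedField.exists_norm_lt 𝕜 (NNReal.coe_pos.2 (ENNReal.coe_pos.1 hr))
  refine ⟨ε, norm_pos_iff.1 hε, lt_of_le_of_lt ?_ hrR⟩
  exact (enorm_le_iff_norm_le.2 (norm_sqrtOp_zero_le ε)).trans (ENNReal.coe_le_coe.2 hεr.le)

/-- Applying the functional calculus of `f` to `sqrtOp` produces the even part of `f` as an analytic
function of the square of the increment. -/
theorem exists_analyticAt_add_sqrt_add_sub_sqrt [CompleteSpace 𝕜] {f : 𝕜 → 𝕜} {z₀ : 𝕜}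
    (hf : AnalyticAt 𝕜 f z₀) :
    ∃ G : 𝕜 × 𝕜 → 𝕜, AnalyticAt 𝕜 G (z₀, 0) ∧
      ∀ᶠ q in 𝓝 (z₀, 0), ∀ s : 𝕜, s ^ 2 = q.2 → G q = f (q.1 + s) + f (q.1 - s) := by
  obtain ⟨p, R, hp⟩ := hf
  obtain ⟨ε, hε0, hε⟩ := exists_enorm_sqrtOp_zero_lt (𝕜 := 𝕜) hp.r_pos
  let T (q : 𝕜 × 𝕜) : 𝕜 × 𝕜 →L[𝕜] 𝕜 × 𝕜 := sqrtOp ε (q - (z₀, 0))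
  have hT : AnalyticAt 𝕜 T (z₀, 0) :=
    (analyticAt_sqrtOp ε _).fun_comp (analyticAt_id.sub analyticAt_const)
  have hTR : ‖T (z₀, 0)‖ₑ < R := by simpa [T] using hε
  let evalSnd : (𝕜 × 𝕜 →L[𝕜] 𝕜 × 𝕜) →L[𝕜] 𝕜 :=
    (ContinuousLinearMap.snd 𝕜 𝕜 𝕜).comp (ContinuousLinearMap.apply 𝕜 (𝕜 × 𝕜) (0, ε + ε))
  refine ⟨fun q => ε⁻¹ * evalSnd (FormalMultilinearSeries.ofScalarsSum p.coeff (T q)), ?_, ?_⟩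
  · have hsum := (hasFPowerSeriesOnBall_ofScalarsSum (𝕜 × 𝕜 →L[𝕜] 𝕜 × 𝕜) hp).analyticAt_of_mem
      (y := T (z₀, 0)) (by simpa using hTR)
    exact analyticAt_const.mul ((evalSnd.analyticAt _).fun_comp (hsum.fun_comp hT))
  · filter_upwards [hT.continuousAt.enorm.eventually_lt continuousAt_const hTR] with q hq s hs
    have heigen (r : 𝕜) (hr : r ^ 2 = q.2) := ofScalarsSum_apply_of_apply_eq_smul hp hq
      (sqrtOp_apply_eigenvector hε0 (q := q - (z₀, 0)) (s := r) (by simpa using hr))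
    have hincr (r : 𝕜) : z₀ + ((q - (z₀, 0)).1 + r) = q.1 + r := by
      rw [Prod.fst_sub]
      ring
    have hsplit : ((0, ε + ε) : 𝕜 × 𝕜) = (s, ε) + (-s, ε) := by simp
    change ε⁻¹ * (FormalMultilinearSeries.ofScalarsSum p.coeff (T q) (0, ε + ε)).2 = _
    rw [hsplit, map_add, heigen s hs, heigen (-s) (by rwa [neg_sq]), hincr, hincr]
    simp only [Prod.snd_add, Prod.smul_snd, smul_eq_mul, ← sub_eq_add_neg]
    field_simp

end EvenPart

section IdentityPrinciple

theorem eventuallyEq_of_eventually_ofReal {F : Type*} [NormedAddCommGroup F] [NormedSpace ℂ F]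
    {f g : ℂ → F} {t : ℝ} (hf : AnalyticAt ℂ f t) (hg : AnalyticAt ℂ g t)
    (h : ∀ᶠ x : ℝ in 𝓝 t, f x = g x) : f =ᶠ[𝓝 (t : ℂ)] g := by
  have hne : Tendsto ((↑) : ℝ → ℂ) (𝓝[≠] t) (𝓝[≠] (t : ℂ)) :=
    continuous_ofReal.continuousWithinAt.tendsto_nhdsWithin fun x hx => by simpa using hx
  exact (hf.frequently_eq_iff_eventually_eq hg).1
    (hne.frequently (h.filter_mono nhdsWithin_le_nhds).frequently)

variable {E F : Type*} [NormedAddCommGroup E] [NormedSpace ℝ E] [NormedAddCommGroup F]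
  [NormedSpace ℝ F] [CompleteSpace F]

theorem eventuallyEq_zero_of_frequently_eventuallyEq {f : E → F} {x₀ : E}
    (hf : AnalyticAt ℝ f x₀) (h : ∃ᶠ x in 𝓝 x₀, f =ᶠ[𝓝 x] 0) : f =ᶠ[𝓝 x₀] 0 := by
  obtain ⟨r, hr, hball⟩ := Metric.eventually_nhds_iff_ball.1 hf.eventually_analyticAt
  obtain ⟨x, hx0, hx⟩ := (h.and_eventually (Metric.ball_mem_nhds x₀ hr)).exists
  exact (AnalyticOnNhd.eqOn_zero_of_preconnected_of_eventuallyEq_zero hball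
    (convex_ball x₀ r).isPreconnected hx hx0).eventuallyEq_of_mem (Metric.ball_mem_nhds x₀ hr)

theorem eventually_eq_zero_of_snd_neg {f : ℝ × ℝ → F} {u : ℝ} (hf : AnalyticAt ℝ f (u, 0))
    (h : ∀ᶠ q in 𝓝 ((u, 0) : ℝ × ℝ), q.2 < 0 → f q = 0) :
    ∀ᶠ q in 𝓝 ((u, 0) : ℝ × ℝ), f q = 0 := by
  have hneg : ∃ᶠ q in 𝓝 ((u, 0) : ℝ × ℝ), q.2 < 0 :=
    ((Continuous.prodMk_right u).tendsto 0).frequently (frequently_lt_nhds 0)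
  refine eventuallyEq_zero_of_frequently_eventuallyEq hf ?_
  refine (hneg.and_eventually h.eventually_nhds).mono fun q hq => ?_
  filter_upwards [hq.2, (isOpen_Iio.preimage continuous_snd).mem_nhds hq.1] with w hw hw0
  exact hw hw0

end IdentityPrinciple

section Limits

variable (u : ℝ)

theorem tendsto_neg_sq : Tendsto (fun q : ℝ × ℝ => (q.1, -q.2 ^ 2)) (𝓝 (u, 0)) (𝓝 (u, 0)) :=
  Continuous.tendsto' (by fun_prop) _ _ (by simp)

theorem tendsto_fst_add_snd : Tendsto (fun q : ℝ × ℝ => q.1 + q.2) (𝓝 (u, 0)) (𝓝 u) :=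
  Continuous.tendsto' (by fun_prop) _ _ (by simp)

theorem tendsto_fst_sub_snd : Tendsto (fun q : ℝ × ℝ => q.1 - q.2) (𝓝 (u, 0)) (𝓝 u) :=
  Continuous.tendsto' (by fun_prop) _ _ (by simp)

variable {u}

theorem eventually_snd_neg_of_eventually_neg_sq {P : ℝ × ℝ → Prop}
    (h : ∀ᶠ q in 𝓝 ((u, 0) : ℝ × ℝ), q.2 ≠ 0 → P (q.1, -q.2 ^ 2)) :
    ∀ᶠ q in 𝓝 ((u, 0) : ℝ × ℝ), q.2 < 0 → P q := by
  have hsqrt : Tendsto (fun q : ℝ × ℝ => (q.1, √(-q.2))) (𝓝 (u, 0)) (𝓝 (u, 0)) :=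
    Continuous.tendsto' (by fun_prop) _ _ (by simp)
  filter_upwards [hsqrt.eventually h] with q hq hneg
  have hpos : 0 < -q.2 := neg_pos.2 hneg
  simpa [Real.sq_sqrt hpos.le] using hq (Real.sqrt_pos.2 hpos).ne'

theorem eventually_eq_zero_of_neg_sq {F : Type*} [NormedAddCommGroup F] [NormedSpace ℝ F]
    [CompleteSpace F] {f : ℝ × ℝ → F} (hf : AnalyticAt ℝ f (u, 0))
    (h : ∀ᶠ q in 𝓝 ((u, 0) : ℝ × ℝ), q.2 ≠ 0 → f (q.1, -q.2 ^ 2) = 0) :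
    ∀ᶠ q in 𝓝 ((u, 0) : ℝ × ℝ), f q = 0 :=
  eventually_eq_zero_of_snd_neg hf (eventually_snd_neg_of_eventually_neg_sq h)

theorem eventually_nhds_fst {P : ℝ × ℝ → Prop} {q : ℝ × ℝ} (h : ∀ᶠ w in 𝓝 q, P w) :
    ∀ᶠ t in 𝓝 q.1, P (t, q.2) :=
  (Continuous.prodMk_left q.2).continuousAt.eventually h

theorem eventually_nhds_snd {P : ℝ × ℝ → Prop} {q : ℝ × ℝ} (h : ∀ᶠ w in 𝓝 q, P w) :
    ∀ᶠ t in 𝓝 q.2, P (q.1, t) :=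
  (Continuous.prodMk_right q.1).continuousAt.eventually h

end Limits

section PartialDerivatives

variable {E : Type*} [NormedAddCommGroup E] [NormedSpace ℝ E] {f g : ℝ × ℝ → E} {q : ℝ × ℝ}

theorem fderiv_apply_eq_d₁_add_d₂ (f : ℝ × ℝ → E) (q w : ℝ × ℝ) :
    fderiv ℝ f q w = w.1 • d₁ f q + w.2 • d₂ f q := by
  have hw : w = w.1 • ((1, 0) : ℝ × ℝ) + w.2 • ((0, 1) : ℝ × ℝ) := by simp
  conv_lhs => rw [hw, map_add, map_smul, map_smul]
  rfl

theorem hasDerivAt_comp_pair {x y : ℝ → ℝ} {a b t : ℝ}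
    (hf : DifferentiableAt ℝ f (x t, y t)) (hx : HasDerivAt x a t) (hy : HasDerivAt y b t) :
    HasDerivAt (fun t => f (x t, y t)) (a • d₁ f (x t, y t) + b • d₂ f (x t, y t)) t := by
  rw [← fderiv_apply_eq_d₁_add_d₂ f (x t, y t) (a, b)]
  exact hf.hasFDerivAt.comp_hasDerivAt t (hx.prodMk hy)

theorem hasDerivAt_d₁ (hf : DifferentiableAt ℝ f q) :
    HasDerivAt (fun t => f (t, q.2)) (d₁ f q) q.1 := by
  simpa using hasDerivAt_comp_pair (t := q.1) hf (hasDerivAt_id _) (hasDerivAt_const _ q.2)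

theorem hasDerivAt_d₂ (hf : DifferentiableAt ℝ f q) :
    HasDerivAt (fun t => f (q.1, t)) (d₂ f q) q.2 := by
  simpa using hasDerivAt_comp_pair (t := q.2) hf (hasDerivAt_const _ q.1) (hasDerivAt_id _)

theorem d₁_congr (h : f =ᶠ[𝓝 q] g) : d₁ f q = d₁ g q := by
  rw [d₁, d₁, h.fderiv_eq]

theorem d₂_congr (h : f =ᶠ[𝓝 q] g) : d₂ f q = d₂ g q := by
  rw [d₂, d₂, h.fderiv_eq]

theorem analyticAt_d₁ [CompleteSpace E] (hf : AnalyticAt ℝ f q) : AnalyticAt ℝ (d₁ f) q :=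
  ((ContinuousLinearMap.apply ℝ E ((1, 0) : ℝ × ℝ)).analyticAt _).fun_comp hf.fderiv

theorem analyticAt_d₂ [CompleteSpace E] (hf : AnalyticAt ℝ f q) : AnalyticAt ℝ (d₂ f) q :=
  ((ContinuousLinearMap.apply ℝ E ((0, 1) : ℝ × ℝ)).analyticAt _).fun_comp hf.fderiv

theorem contDiffAt_d₁ {m n : WithTop ℕ∞} (hf : ContDiffAt ℝ n f q) (hmn : m + 1 ≤ n) :
    ContDiffAt ℝ m (d₁ f) q :=
  (hf.fderiv_right hmn).clm_apply contDiffAt_const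

theorem contDiffAt_d₂ {m n : WithTop ℕ∞} (hf : ContDiffAt ℝ n f q) (hmn : m + 1 ≤ n) :
    ContDiffAt ℝ m (d₂ f) q :=
  (hf.fderiv_right hmn).clm_apply contDiffAt_const

theorem differentiableAt_d₁ (hf : ContDiffAt ℝ 2 f q) : DifferentiableAt ℝ (d₁ f) q :=
  (contDiffAt_d₁ (m := 1) hf (by norm_num)).differentiableAt one_ne_zero

theorem differentiableAt_d₂ (hf : ContDiffAt ℝ 2 f q) : DifferentiableAt ℝ (d₂ f) q :=
  (contDiffAt_d₂ (m := 1) hf (by norm_num)).differentiableAt one_ne_zero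

theorem d₂_d₁_comm (hf : ContDiffAt ℝ 2 f q) : d₂ (d₁ f) q = d₁ (d₂ f) q := by
  have hd : DifferentiableAt ℝ (fderiv ℝ f) q :=
    (hf.fderiv_right (m := 1) (by norm_num)).differentiableAt one_ne_zero
  have hsecond (v w : ℝ × ℝ) :
      fderiv ℝ (fun x => fderiv ℝ f x v) q w = fderiv ℝ (fderiv ℝ f) q w v := by
    rw [fderiv_clm_apply hd (differentiableAt_const v)]
    simp
  exact ((hsecond _ _).trans ((hf.isSymmSndFDerivAt (by simp)) _ _)).trans (hsecond _ _).symm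

theorem hasDerivAt_second {f : ℝ × ℝ → ℝ} {x y x' y' : ℝ → ℝ} {a b t : ℝ}
    (h₁ : DifferentiableAt ℝ (d₁ f) (x t, y t)) (h₂ : DifferentiableAt ℝ (d₂ f) (x t, y t))
    (hx : HasDerivAt x (x' t) t) (hy : HasDerivAt y (y' t) t)
    (hx' : HasDerivAt x' a t) (hy' : HasDerivAt y' b t) :
    HasDerivAt (fun s => x' s * d₁ f (x s, y s) + y' s * d₂ f (x s, y s))
      (a * d₁ f (x t, y t) + b * d₂ f (x t, y t) +
        x' t * (x' t * d₁ (d₁ f) (x t, y t) + y' t * d₂ (d₁ f) (x t, y t)) +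
        y' t * (x' t * d₁ (d₂ f) (x t, y t) + y' t * d₂ (d₂ f) (x t, y t))) t := by
  refine ((hx'.mul (hasDerivAt_comp_pair h₁ hx hy)).add
    (hy'.mul (hasDerivAt_comp_pair h₂ hx hy))).congr_deriv ?_
  simp only [smul_eq_mul]
  ring

theorem exists_openPartialHomeomorph {F : Type*} [NormedAddCommGroup F] [NormedSpace ℝ F]
    [FiniteDimensional ℝ F] {X : F → F} {x₀ : F} {n : WithTop ℕ∞}
    (hX : ContDiffAt ℝ n X x₀) (hn : n ≠ 0) (hinj : Function.Injective (fderiv ℝ X x₀)) :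
    ∃ e : OpenPartialHomeomorph F F, (∀ x, e x = X x) ∧ x₀ ∈ e.source ∧
      ContDiffAt ℝ n e.symm (X x₀) := by
  have : CompleteSpace F := FiniteDimensional.complete ℝ F
  let L : F ≃L[ℝ] F :=
    (LinearEquiv.ofInjectiveEndo (fderiv ℝ X x₀ : F →ₗ[ℝ] F) hinj).toContinuousLinearEquiv
  have hL : HasFDerivAt X (L : F →L[ℝ] F) x₀ := by
    convert! (hX.differentiableAt hn).hasFDerivAt using 1
  exact ⟨hX.toOpenPartialHomeomorph X hL hn, fun _ => rfl,
    hX.mem_toOpenPartialHomeomorph_source hL hn, hX.to_localInverse hL hn⟩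

end PartialDerivatives

section HolomorphicExtension

theorem exists_analyticAt_eventually_eq_ofReal {g : ℝ → ℝ} {t : ℝ} (hg : AnalyticAt ℝ g t) :
    ∃ C : ℂ → ℂ, AnalyticAt ℂ C t ∧ ∀ᶠ x : ℝ in 𝓝 t, C x = g x := by
  obtain ⟨p, R, hp⟩ := hg
  let P := FormalMultilinearSeries.ofScalars ℂ fun n => (p.coeff n : ℂ)
  have hradius : P.radius = p.radius := by
    simp only [P, FormalMultilinearSeries.radius, FormalMultilinearSeries.norm_apply_eq_norm_coef,
      FormalMultilinearSeries.coeff_ofScalars, norm_real]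
  have hR : R ≤ P.radius := hradius ▸ hp.r_le
  have hP := (P.hasFPowerSeriesOnBall (hp.r_pos.trans_le hR)).mono hp.r_pos hR
  refine ⟨fun z => P.sum (z - t), ?_, ?_⟩
  · exact AnalyticAt.fun_comp (g := P.sum) (by simpa using hP.analyticAt)
      (analyticAt_id.sub analyticAt_const)
  filter_upwards [Metric.eball_mem_nhds t hp.r_pos] with x hx
  have hxR : ‖x - t‖ₑ < R := by simpa [edist_eq_enorm_sub] using hx
  have hsum := (hp.hasSum (y := x - t) (by simpa using hxR)).mapL ofRealCLM
  have hsumC := hP.hasSum (y := ((x - t : ℝ) : ℂ))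
    (by simpa only [Metric.mem_eball, edist_zero_right, enorm_eq_nnnorm, nnnorm_real] using hxR)
  rw [add_sub_cancel] at hsum
  rw [zero_add] at hsumC
  rw [← ofReal_sub]
  have hterm (n : ℕ) : (P n fun _ => ((x - t : ℝ) : ℂ)) = ((p n fun _ => x - t : ℝ) : ℂ) := by
    simp [P, mul_comm]
  simp only [hterm] at hsumC
  exact hsumC.unique hsum

theorem exists_ball_extension {γ : ℝ → Mink} {t : ℝ} (hγ : AnalyticAt ℝ γ t) :
    ∃ (r : ℝ) (C : ℂ → Fin 3 → ℂ), 0 < r ∧ AnalyticOnNhd ℂ C (Metric.ball t r) ∧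
      ∀ x : ℝ, (x : ℂ) ∈ Metric.ball (t : ℂ) r → ∀ j, C x j = γ x j := by
  choose C hC hCγ using fun j => exists_analyticAt_eventually_eq_ofReal (analyticAt_pi_iff.1 hγ j)
  obtain ⟨r₁, hr₁, han⟩ := Metric.eventually_nhds_iff_ball.1
    (analyticAt_pi_iff.2 hC : AnalyticAt ℂ (fun z j => C j z) t).eventually_analyticAt
  obtain ⟨r₂, hr₂, heq⟩ := Metric.eventually_nhds_iff_ball.1 (eventually_all.2 hCγ)
  refine ⟨min r₁ r₂, fun z j => C j z, lt_min hr₁ hr₂,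
    fun z hz => han z (Metric.ball_subset_ball (min_le_left _ _) hz), fun x hx => heq x ?_⟩
  have hx₂ := Metric.ball_subset_ball (min_le_right r₁ r₂) hx
  rwa [Metric.mem_ball, (isometry_ofReal).dist_eq] at hx₂

theorem ofReal_re_mem_ball {t r : ℝ} {z : ℂ} (hz : z ∈ Metric.ball (t : ℂ) r) :
    (z.re : ℂ) ∈ Metric.ball (t : ℂ) r := by
  rw [Metric.mem_ball, dist_eq_norm] at hz ⊢
  rw [← ofReal_sub, norm_real]
  exact (abs_re_le_norm (z - t)).trans_lt hz

theorem eqOn_ball_inter_ball {F : Type*} [NormedAddCommGroup F] [NormedSpace ℂ F] {f g : ℂ → F}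
    {s t r r' : ℝ} (hf : AnalyticOnNhd ℂ f (Metric.ball s r))
    (hg : AnalyticOnNhd ℂ g (Metric.ball t r'))
    (h : ∀ x : ℝ, (x : ℂ) ∈ Metric.ball (s : ℂ) r → (x : ℂ) ∈ Metric.ball (t : ℂ) r' →
      f x = g x) :
    Set.EqOn f g (Metric.ball s r ∩ Metric.ball t r') := by
  intro z hz
  have hre := And.intro (ofReal_re_mem_ball hz.1) (ofReal_re_mem_ball hz.2)
  have hpre := ((convex_ball (s : ℂ) r).inter (convex_ball (t : ℂ) r')).isPreconnected
  refine (hf.mono Set.inter_subset_left).eqOn_of_preconnected_of_eventuallyEq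
    (hg.mono Set.inter_subset_right) hpre hre ?_ hz
  refine eventuallyEq_of_eventually_ofReal (hf _ hre.1) (hg _ hre.2) ?_
  filter_upwards [continuous_ofReal.continuousAt
    ((Metric.isOpen_ball.inter Metric.isOpen_ball).mem_nhds hre)] with x hx using h x hx.1 hx.2

theorem exists_holomorphicExtension {I : Set ℝ} {γ : ℝ → Mink} (hγ : AnalyticOnNhd ℝ γ I) :
    ∃ (U : Set ℂ) (Γ : ℂ → Fin 3 → ℂ), IsHolomorphicExtension I γ U Γ := by
  classical
  choose r C hr hC hCγ using fun t : I => exists_ball_extension (hγ t t.2)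
  let B (t : I) : Set ℂ := Metric.ball (t : ℝ) (r t)
  let Γ (z : ℂ) : Fin 3 → ℂ := if h : ∃ t, z ∈ B t then C h.choose z else 0
  have hΓ (t : I) : Set.EqOn Γ (C t) (B t) := by
    intro z hz
    have h : ∃ t, z ∈ B t := ⟨t, hz⟩
    simp only [Γ, dif_pos h]
    refine eqOn_ball_inter_ball (hC _) (hC t) (fun x hs ht => funext fun j => ?_)
      ⟨h.choose_spec, hz⟩
    rw [hCγ _ x hs, hCγ t x ht]
  have hcenter (t : I) : ((t : ℝ) : ℂ) ∈ B t := Metric.mem_ball_self (hr t)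
  refine ⟨⋃ t, B t, Γ, isOpen_iUnion fun t => Metric.isOpen_ball,
    fun t ht => Set.mem_iUnion.2 ⟨⟨t, ht⟩, hcenter ⟨t, ht⟩⟩, fun z hz => ?_, fun t ht j => ?_⟩
  · obtain ⟨t, ht⟩ := Set.mem_iUnion.1 hz
    exact ((hC t z ht).differentiableAt.congr_of_eventuallyEq
      ((hΓ t).eventuallyEq_of_mem (Metric.isOpen_ball.mem_nhds ht))).differentiableWithinAt
  · rw [hΓ ⟨t, ht⟩ (hcenter ⟨t, ht⟩), hCγ ⟨t, ht⟩ t (hcenter ⟨t, ht⟩)]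

end HolomorphicExtension

section PhiHat

theorem exists_sq_eq_neg_phiHatC_eq (Γ : ℂ → Fin 3 → ℂ) (q : ℝ × ℝ) :
    ∃ w : ℂ, w ^ 2 = ((-q.2 : ℝ) : ℂ) ∧
      phiHatC Γ q = (2⁻¹ : ℂ) • (Γ (q.1 + w) + Γ (q.1 - w)) := by
  by_cases hq : 0 ≤ q.2
  · refine ⟨I * (√q.2 : ℝ), ?_, if_pos hq⟩
    rw [mul_pow, I_sq, ← ofReal_pow, Real.sq_sqrt hq, neg_one_mul, ofReal_neg]
  · refine ⟨(√|q.2| : ℝ), ?_, ?_⟩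
    · rw [← ofReal_pow, Real.sq_sqrt (abs_nonneg _), abs_of_neg (not_le.1 hq)]
    · rw [phiHatC, if_neg hq, ofReal_add, ofReal_sub]

theorem phiHatC_neg_sq (Γ : ℂ → Fin 3 → ℂ) (u s : ℝ) :
    phiHatC Γ (u, -s ^ 2) = (2⁻¹ : ℂ) • (Γ (u + s : ℝ) + Γ (u - s : ℝ)) := by
  obtain ⟨w, hw, h⟩ := exists_sq_eq_neg_phiHatC_eq Γ (u, -s ^ 2)
  rw [neg_neg, ofReal_pow] at hw
  rw [h, ofReal_add, ofReal_sub]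
  rcases sq_eq_sq_iff_eq_or_eq_neg.1 hw with rfl | rfl
  · rfl
  · rw [sub_neg_eq_add, ← sub_eq_add_neg, add_comm]

variable {I : Set ℝ} {γ : ℝ → Mink} {U : Set ℂ} {Γ : ℂ → Fin 3 → ℂ} {u : ℝ}

theorem IsHolomorphicExtension.analyticAt (h : IsHolomorphicExtension I γ U Γ) (hu : u ∈ I) :
    AnalyticAt ℂ Γ u :=
  h.holomorphic.analyticAt (h.isOpen.mem_nhds (h.subset u hu))

theorem IsHolomorphicExtension.eventually_mem_phiHatDomain (h : IsHolomorphicExtension I γ U Γ)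
    (hI : IsOpen I) (hu : u ∈ I) : ∀ᶠ q in 𝓝 ((u, 0) : ℝ × ℝ), q ∈ phiHatDomain I U := by
  have hplus : ContinuousAt (fun q : ℝ × ℝ => (q.1 + Complex.I * (√q.2 : ℝ) : ℂ)) (u, 0) := by
    fun_prop
  have hminus : ContinuousAt (fun q : ℝ × ℝ => (q.1 - Complex.I * (√q.2 : ℝ) : ℂ)) (u, 0) := by
    fun_prop
  have hadd : ContinuousAt (fun q : ℝ × ℝ => q.1 + √|q.2|) (u, 0) := by fun_prop
  have hsub : ContinuousAt (fun q : ℝ × ℝ => q.1 - √|q.2|) (u, 0) := by fun_prop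
  filter_upwards [hplus (h.isOpen.mem_nhds (by simpa using h.subset u hu)),
    hminus (h.isOpen.mem_nhds (by simpa using h.subset u hu)),
    hadd (hI.mem_nhds (by simpa using hu)), hsub (hI.mem_nhds (by simpa using hu))]
    with q h₁ h₂ h₃ h₄
  exact ⟨fun _ => ⟨h₁, h₂⟩, fun _ => ⟨h₃, h₄⟩⟩

theorem analyticAt_phiHat (hΓ : AnalyticAt ℂ Γ u) : AnalyticAt ℝ (phiHat Γ) (u, 0) := by
  refine analyticAt_pi_iff.2 fun j => ?_
  obtain ⟨G, hG, hGΓ⟩ := exists_analyticAt_add_sqrt_add_sub_sqrt (analyticAt_pi_iff.1 hΓ j)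
  have harg : AnalyticAt ℝ (fun q : ℝ × ℝ => ((q.1 : ℂ), ((-q.2 : ℝ) : ℂ))) (u, 0) :=
    ((ofRealCLM.analyticAt _).fun_comp analyticAt_fst).prod
      ((ofRealCLM.analyticAt _).fun_comp analyticAt_snd.neg)
  have hG' : AnalyticAt ℝ (fun q : ℝ × ℝ => G ((q.1 : ℂ), ((-q.2 : ℝ) : ℂ))) (u, 0) :=
    AnalyticAt.fun_comp (g := G) (by simpa using hG.restrictScalars) harg
  have hre : AnalyticAt ℝ (fun q : ℝ × ℝ => 2⁻¹ * (G ((q.1 : ℂ), ((-q.2 : ℝ) : ℂ))).re) (u, 0) :=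
    analyticAt_const.mul ((reCLM.analyticAt _).fun_comp hG')
  refine hre.congr ?_
  filter_upwards [harg.continuousAt.tendsto.eventually (by simpa using hGΓ)] with q hq
  obtain ⟨w, hw, hφ⟩ := exists_sq_eq_neg_phiHatC_eq Γ q
  rw [phiHat, hφ, hq w hw]
  simp

theorem eventually_conj_apply_conj_eq {C : ℂ → ℂ} (hC : AnalyticAt ℂ C u)
    (hreal : ∀ᶠ x : ℝ in 𝓝 u, (C x).im = 0) :
    ∀ᶠ z in 𝓝 (u : ℂ), starRingEnd ℂ (C (starRingEnd ℂ z)) = C z := by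
  refine eventuallyEq_of_eventually_ofReal ?_ hC ?_
  · refine analyticAt_iff_eventually_differentiableAt.2 ?_
    have hconj : Tendsto (starRingEnd ℂ) (𝓝 (u : ℂ)) (𝓝 (u : ℂ)) :=
      continuous_conj.tendsto' _ _ (conj_ofReal u)
    filter_upwards [hconj.eventually hC.eventually_analyticAt] with z hz
    exact differentiableAt_conj_conj_iff.2 hz.differentiableAt
  · filter_upwards [hreal] with x hx
    rw [conj_ofReal, conj_eq_iff_im, hx]

theorem eventually_phiHatC_eq_ofReal_phiHat (h : IsHolomorphicExtension I γ U Γ) (hI : IsOpen I)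
    (hu : u ∈ I) : ∀ᶠ q in 𝓝 ((u, 0) : ℝ × ℝ), ∀ j, phiHatC Γ q j = (phiHat Γ q j : ℂ) := by
  refine eventually_all.2 fun j => ?_
  have hreflect := eventually_conj_apply_conj_eq (analyticAt_pi_iff.1 (h.analyticAt hu) j) (by
    filter_upwards [hI.mem_nhds hu] with x hx
    rw [h.agree x hx, ofReal_im])
  have harg : Tendsto (fun q : ℝ × ℝ => (q.1 + Complex.I * (√q.2 : ℝ) : ℂ)) (𝓝 (u, 0)) (𝓝 u) :=
    Continuous.tendsto' (by fun_prop) _ _ (by simp)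
  filter_upwards [h.eventually_mem_phiHatDomain hI hu, harg.eventually hreflect] with q hq hconj
  refine (conj_eq_iff_re.1 (conj_eq_iff_im.2 ?_)).symm
  rcases le_or_gt 0 q.2 with hv | hv
  · have hcc : starRingEnd ℂ (q.1 + Complex.I * (√q.2 : ℝ)) = q.1 - Complex.I * (√q.2 : ℝ) := by
      simp [sub_eq_add_neg]
    rw [hcc] at hconj
    simp [phiHatC, hv, ← hconj]
  · obtain ⟨hadd, hsub⟩ := hq.2 hv
    simp only [phiHatC, if_neg (not_le.2 hv), Pi.smul_apply, Pi.add_apply, h.agree _ hadd,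
      h.agree _ hsub, ← ofReal_add]
    simp

theorem IsHolomorphicExtension.phiHat_neg_sq (h : IsHolomorphicExtension I γ U Γ) {s : ℝ}
    (hadd : u + s ∈ I) (hsub : u - s ∈ I) :
    phiHat Γ (u, -s ^ 2) = (2⁻¹ : ℝ) • (γ (u + s) + γ (u - s)) := by
  funext j
  rw [phiHat, phiHatC_neg_sq, Pi.smul_apply, Pi.add_apply, h.agree _ hadd, h.agree _ hsub]
  simp

end PhiHat

section Lorentz

variable (a b c : Mink) (k : ℝ)

theorem lorentz_add_left : lorentz (a + b) c = lorentz a c + lorentz b c := by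
  simp only [lorentz, Pi.add_apply]
  ring

theorem lorentz_smul_left : lorentz (k • a) b = k * lorentz a b := by
  simp only [lorentz, Pi.smul_apply, smul_eq_mul]
  ring

theorem lorentz_smul_right : lorentz a (k • b) = k * lorentz a b := by
  simp only [lorentz, Pi.smul_apply, smul_eq_mul]
  ring

theorem lorentz_lorentzCross_right : lorentz b (lorentzCross a b) = 0 := by
  simp only [lorentz, lorentzCross, Matrix.cons_val]
  ring

variable {a b}

theorem lorentz_half_add_half_sub (ha : lorentz a a = 0) (hb : lorentz b b = 0) :
    lorentz ((2⁻¹ : ℝ) • (a + b)) ((2⁻¹ : ℝ) • (a - b)) = 0 := by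
  simp only [lorentz, Pi.smul_apply, Pi.add_apply, Pi.sub_apply, smul_eq_mul] at ha hb ⊢
  linear_combination 4⁻¹ * ha - 4⁻¹ * hb

theorem lorentz_half_add_self (ha : lorentz a a = 0) (hb : lorentz b b = 0) :
    lorentz ((2⁻¹ : ℝ) • (a + b)) ((2⁻¹ : ℝ) • (a + b)) =
      -lorentz ((2⁻¹ : ℝ) • (a - b)) ((2⁻¹ : ℝ) • (a - b)) := by
  simp only [lorentz, Pi.smul_apply, Pi.add_apply, Pi.sub_apply, smul_eq_mul] at ha hb ⊢
  linear_combination 2⁻¹ * ha + 2⁻¹ * hb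

theorem analyticAt_lorentz {v w : ℝ × ℝ → Mink} {q : ℝ × ℝ} (hv : AnalyticAt ℝ v q)
    (hw : AnalyticAt ℝ w q) : AnalyticAt ℝ (fun q => lorentz (v q) (w q)) q := by
  have hv' := analyticAt_pi_iff.1 hv
  have hw' := analyticAt_pi_iff.1 hw
  exact (((hv' 0).mul (hw' 0)).neg.add ((hv' 1).mul (hw' 1))).add ((hv' 2).mul (hw' 2))

end Lorentz

section SymmetricAverage

/-- The map `φ`, analytic near `(u, 0)`, is there on the side `v < 0` the average
`½ (g(u + √|v|) + g(u - √|v|))`. The condition is written with `v = -s²`, which keeps both sides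
smooth in `s`. -/
structure IsSymmetricAverage {E : Type*} [NormedAddCommGroup E] [NormedSpace ℝ E]
    (φ : ℝ × ℝ → E) (g : ℝ → E) (u : ℝ) : Prop where
  analyticAt : AnalyticAt ℝ φ (u, 0)
  analyticAt_curve : AnalyticAt ℝ g u
  eventually_eq : ∀ᶠ q in 𝓝 ((u, 0) : ℝ × ℝ),
    φ (q.1, -q.2 ^ 2) = (2⁻¹ : ℝ) • (g (q.1 + q.2) + g (q.1 - q.2))

theorem IsHolomorphicExtension.isSymmetricAverage_phiHat {I : Set ℝ} {γ : ℝ → Mink} {U : Set ℂ}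
    {Γ : ℂ → Fin 3 → ℂ} {u : ℝ} (h : IsHolomorphicExtension I γ U Γ)
    (hγ : AnalyticOnNhd ℝ γ I) (hI : IsOpen I) (hu : u ∈ I) :
    IsSymmetricAverage (phiHat Γ) γ u where
  analyticAt := analyticAt_phiHat (h.analyticAt hu)
  analyticAt_curve := hγ u hu
  eventually_eq := by
    filter_upwards [(tendsto_fst_add_snd u).eventually (hI.mem_nhds hu),
      (tendsto_fst_sub_snd u).eventually (hI.mem_nhds hu)] with q hadd hsub
    exact h.phiHat_neg_sq hadd hsub

variable {E : Type*} [NormedAddCommGroup E] [NormedSpace ℝ E]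

theorem hasDerivAt_neg_sq (s : ℝ) : HasDerivAt (fun t : ℝ => -t ^ 2) (-2 * s) s := by
  simpa using (hasDerivAt_pow 2 s).fun_neg

namespace IsSymmetricAverage

variable [CompleteSpace E] {φ : ℝ × ℝ → E} {g : ℝ → E} {u : ℝ}

theorem eventually_analyticAt (h : IsSymmetricAverage φ g u) :
    ∀ᶠ q in 𝓝 ((u, 0) : ℝ × ℝ), AnalyticAt ℝ φ (q.1, -q.2 ^ 2) ∧
      AnalyticAt ℝ g (q.1 + q.2) ∧ AnalyticAt ℝ g (q.1 - q.2) :=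
  ((tendsto_neg_sq u).eventually h.analyticAt.eventually_analyticAt).and
    (((tendsto_fst_add_snd u).eventually h.analyticAt_curve.eventually_analyticAt).and
      ((tendsto_fst_sub_snd u).eventually h.analyticAt_curve.eventually_analyticAt))

theorem map_d₁ (h : IsSymmetricAverage φ g u) :
    IsSymmetricAverage (d₁ φ) (deriv g) u where
  analyticAt := analyticAt_d₁ h.analyticAt
  analyticAt_curve := h.analyticAt_curve.deriv
  eventually_eq := by
    filter_upwards [h.eventually_eq.eventually_nhds, h.eventually_analyticAt] with
      q hq ⟨hφ, hadd, hsub⟩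
    have havg := ((hadd.differentiableAt.hasDerivAt.comp_add_const q.1 q.2).add
      (hsub.differentiableAt.hasDerivAt.comp_sub_const q.1 q.2)).const_smul (2⁻¹ : ℝ)
    exact (hasDerivAt_d₁ hφ.differentiableAt).unique
      (havg.congr_of_eventuallyEq (eventually_nhds_fst hq))

theorem eventually_smul_d₂ (h : IsSymmetricAverage φ g u) :
    ∀ᶠ q in 𝓝 ((u, 0) : ℝ × ℝ), (-2 * q.2) • d₂ φ (q.1, -q.2 ^ 2) =
      (2⁻¹ : ℝ) • (deriv g (q.1 + q.2) - deriv g (q.1 - q.2)) := by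
  filter_upwards [h.eventually_eq.eventually_nhds, h.eventually_analyticAt] with
    q hq ⟨hφ, hadd, hsub⟩
  have havg := ((hadd.differentiableAt.hasDerivAt.comp_const_add q.1 q.2).add
    (hsub.differentiableAt.hasDerivAt.comp_const_sub q.1 q.2)).const_smul (2⁻¹ : ℝ)
  have hchain := hasDerivAt_comp_pair (x := fun _ => q.1) (y := fun t => -t ^ 2) (t := q.2)
    hφ.differentiableAt (hasDerivAt_const _ q.1) (hasDerivAt_neg_sq q.2)
  simpa [sub_eq_add_neg] using
    hchain.unique (havg.congr_of_eventuallyEq (eventually_nhds_snd hq))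

theorem eventually_d₂_d₂ (h : IsSymmetricAverage φ g u) :
    ∀ᶠ q in 𝓝 ((u, 0) : ℝ × ℝ),
      (4 * q.2 ^ 2) • d₂ (d₂ φ) (q.1, -q.2 ^ 2) - (2 : ℝ) • d₂ φ (q.1, -q.2 ^ 2) =
        (2⁻¹ : ℝ) • (deriv (deriv g) (q.1 + q.2) + deriv (deriv g) (q.1 - q.2)) := by
  filter_upwards [h.eventually_smul_d₂.eventually_nhds,
    (tendsto_neg_sq u).eventually (analyticAt_d₂ h.analyticAt).eventually_analyticAt,
    h.map_d₁.eventually_analyticAt] with q hq hφ ⟨_, hadd, hsub⟩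
  have havg := ((hadd.differentiableAt.hasDerivAt.comp_const_add q.1 q.2).sub
    (hsub.differentiableAt.hasDerivAt.comp_const_sub q.1 q.2)).const_smul (2⁻¹ : ℝ)
  have hchain := ((hasDerivAt_id q.2).const_mul (-2)).smul
    (hasDerivAt_comp_pair (x := fun _ => q.1) (y := fun t => -t ^ 2) (t := q.2)
      hφ.differentiableAt (hasDerivAt_const _ q.1) (hasDerivAt_neg_sq q.2))
  have heq := hchain.unique (havg.congr_of_eventuallyEq (eventually_nhds_snd hq))
  rw [sub_neg_eq_add] at heq
  rw [← heq, id_eq, zero_smul, zero_add, smul_smul, sub_eq_add_neg, mul_one, neg_smul]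
  ring_nf

theorem d₁_eq_deriv (h : IsSymmetricAverage φ g u) : d₁ φ (u, 0) = deriv g u := by
  have heq := h.map_d₁.eventually_eq.self_of_nhds
  simpa [← two_smul ℝ (deriv g u), smul_smul] using heq

theorem d₂_eq_deriv_deriv (h : IsSymmetricAverage φ g u) :
    d₂ φ (u, 0) = (-2⁻¹ : ℝ) • deriv (deriv g) u := by
  have heq := h.eventually_d₂_d₂.self_of_nhds
  simp only [ne_eq, OfNat.ofNat_ne_zero, not_false_eq_true, zero_pow, neg_zero, mul_zero,
    zero_smul, zero_sub, add_zero, sub_zero, ← two_smul ℝ (deriv (deriv g) u), smul_smul,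
    inv_mul_cancel₀, one_smul] at heq
  rw [← heq, neg_smul, smul_neg, neg_neg, smul_smul]
  norm_num

end IsSymmetricAverage

end SymmetricAverage

section ConformalSystem

/-- The differential equations satisfied by `φ̂_γ`. In the coordinate `s` with `v = -s²` they say
that `φ` solves the wave equation `φ_uu = φ_ss` and that `(u, s)` are isothermal parameters. -/
structure ConformalSystem (φ : ℝ × ℝ → Mink) (q : ℝ × ℝ) : Prop where
  wave : d₁ (d₁ φ) q + (4 * q.2) • d₂ (d₂ φ) q + (2 : ℝ) • d₂ φ q = 0
  orthogonal : lorentz (d₁ φ q) (d₂ φ q) = 0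
  conformal : lorentz (d₁ φ q) (d₁ φ q) = 4 * q.2 * lorentz (d₂ φ q) (d₂ φ q)

variable {φ : ℝ × ℝ → Mink}

theorem ConformalSystem.meanCurvatureNumerator_eq_zero {q : ℝ × ℝ}
    (h : ConformalSystem φ q) : meanCurvatureNumerator φ q = 0 := by
  have hwave := congrArg (fun v => lorentz v (normal φ q)) h.wave
  have hnormal : lorentz (d₂ φ q) (normal φ q) = 0 := lorentz_lorentzCross_right _ _
  simp only [lorentz_add_left, lorentz_smul_left, hnormal] at hwave
  have hzero : lorentz 0 (normal φ q) = 0 := by simp [lorentz]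
  rw [meanCurvatureNumerator, h.orthogonal, h.conformal]
  linear_combination lorentz (d₂ φ q) (d₂ φ q) * (hwave + hzero)

namespace IsSymmetricAverage

variable {γ : ℝ → Mink} {u : ℝ}

theorem eventually_wave (h : IsSymmetricAverage φ γ u) :
    ∀ᶠ q in 𝓝 ((u, 0) : ℝ × ℝ),
      d₁ (d₁ φ) q + (4 * q.2) • d₂ (d₂ φ) q + (2 : ℝ) • d₂ φ q = 0 := by
  have hφ₂ := analyticAt_d₂ h.analyticAt
  refine eventually_eq_zero_of_neg_sq ((h.map_d₁.map_d₁.analyticAt.add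
    ((analyticAt_const.mul analyticAt_snd).fun_smul (analyticAt_d₂ hφ₂))).add
    (analyticAt_const.fun_smul hφ₂)) ?_
  filter_upwards [h.map_d₁.map_d₁.eventually_eq, h.eventually_d₂_d₂] with q h₁ h₂ _
  change d₁ (d₁ φ) (q.1, -q.2 ^ 2) +
    (4 * -q.2 ^ 2) • d₂ (d₂ φ) (q.1, -q.2 ^ 2) + (2 : ℝ) • d₂ φ (q.1, -q.2 ^ 2) = 0
  rw [h₁, ← h₂, mul_neg, neg_smul]
  abel

theorem eventually_orthogonal (h : IsSymmetricAverage φ γ u)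
    (hnull : ∀ᶠ t in 𝓝 u, lorentz (deriv γ t) (deriv γ t) = 0) :
    ∀ᶠ q in 𝓝 ((u, 0) : ℝ × ℝ), lorentz (d₁ φ q) (d₂ φ q) = 0 := by
  refine eventually_eq_zero_of_neg_sq
    (analyticAt_lorentz h.map_d₁.analyticAt (analyticAt_d₂ h.analyticAt)) ?_
  filter_upwards [h.map_d₁.eventually_eq, h.eventually_smul_d₂,
    (tendsto_fst_add_snd u).eventually hnull, (tendsto_fst_sub_snd u).eventually hnull]
    with q h₁ h₂ hadd hsub hne
  have hprod := lorentz_half_add_half_sub hadd hsub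
  rw [← h₁, ← h₂, lorentz_smul_right] at hprod
  simpa [hne] using hprod

theorem eventually_conformal (h : IsSymmetricAverage φ γ u)
    (hnull : ∀ᶠ t in 𝓝 u, lorentz (deriv γ t) (deriv γ t) = 0) :
    ∀ᶠ q in 𝓝 ((u, 0) : ℝ × ℝ), lorentz (d₁ φ q) (d₁ φ q) -
      4 * q.2 * lorentz (d₂ φ q) (d₂ φ q) = 0 := by
  have hφ₁ := h.map_d₁.analyticAt
  have hφ₂ := analyticAt_d₂ h.analyticAt
  refine eventually_eq_zero_of_neg_sq ((analyticAt_lorentz hφ₁ hφ₁).sub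
    ((analyticAt_const.mul analyticAt_snd).mul (analyticAt_lorentz hφ₂ hφ₂))) ?_
  filter_upwards [h.map_d₁.eventually_eq, h.eventually_smul_d₂,
    (tendsto_fst_add_snd u).eventually hnull, (tendsto_fst_sub_snd u).eventually hnull]
    with q h₁ h₂ hadd hsub _
  have hself := lorentz_half_add_self hadd hsub
  rw [← h₁, ← h₂, lorentz_smul_left, lorentz_smul_right] at hself
  linear_combination hself

theorem eventually_conformalSystem (h : IsSymmetricAverage φ γ u)
    (hnull : ∀ᶠ t in 𝓝 u, lorentz (deriv γ t) (deriv γ t) = 0) :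
    ∀ᶠ q in 𝓝 ((u, 0) : ℝ × ℝ), ConformalSystem φ q := by
  filter_upwards [h.eventually_wave, h.eventually_orthogonal hnull,
    h.eventually_conformal hnull] with q hwave horth hconf
  exact ⟨hwave, horth, sub_eq_zero.1 hconf⟩

end IsSymmetricAverage

end ConformalSystem

section Projection

/-- The projection of a surface to the `xy`-plane, over which it is to be written as a graph. -/
def proj (φ : ℝ × ℝ → Mink) (q : ℝ × ℝ) : ℝ × ℝ := (φ q 1, φ q 2)

/-- The Jacobian determinant of `proj φ`. -/
noncomputable def jac (φ : ℝ × ℝ → Mink) (q : ℝ × ℝ) : ℝ :=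
  d₁ φ q 1 * d₂ φ q 2 - d₁ φ q 2 * d₂ φ q 1

variable {φ : ℝ × ℝ → Mink} {q : ℝ × ℝ}

theorem analyticAt_proj (hφ : AnalyticAt ℝ φ q) : AnalyticAt ℝ (proj φ) q :=
  (analyticAt_pi_iff.1 hφ 1).prod (analyticAt_pi_iff.1 hφ 2)

theorem analyticAt_jac (hφ : AnalyticAt ℝ φ q) : AnalyticAt ℝ (jac φ) q := by
  have hφ₁ := analyticAt_pi_iff.1 (analyticAt_d₁ hφ)
  have hφ₂ := analyticAt_pi_iff.1 (analyticAt_d₂ hφ)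
  exact ((hφ₁ 1).mul (hφ₂ 2)).sub ((hφ₁ 2).mul (hφ₂ 1))

theorem fderiv_proj_apply (hφ : DifferentiableAt ℝ φ q) (w : ℝ × ℝ) :
    fderiv ℝ (proj φ) q w = (fderiv ℝ φ q w 1, fderiv ℝ φ q w 2) := by
  have hpi := hasFDerivAt_pi'.1 hφ.hasFDerivAt
  have hproj : HasFDerivAt (proj φ) _ q := (hpi 1).prodMk (hpi 2)
  rw [hproj.fderiv]
  rfl

theorem injective_fderiv_proj (hφ : DifferentiableAt ℝ φ q) (hjac : jac φ q ≠ 0) :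
    Function.Injective (fderiv ℝ (proj φ) q) := by
  refine (injective_iff_map_eq_zero _).2 fun w hw => ?_
  simp only [fderiv_proj_apply hφ, fderiv_apply_eq_d₁_add_d₂, Pi.add_apply, Pi.smul_apply,
    smul_eq_mul, Prod.mk_eq_zero] at hw
  have hfst : w.1 * jac φ q = 0 := by
    rw [jac]
    linear_combination d₂ φ q 2 * hw.1 - d₂ φ q 1 * hw.2
  have hsnd : w.2 * jac φ q = 0 := by
    rw [jac]
    linear_combination d₁ φ q 1 * hw.2 - d₁ φ q 2 * hw.1
  exact Prod.ext ((mul_eq_zero.1 hfst).resolve_right hjac)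
    ((mul_eq_zero.1 hsnd).resolve_right hjac)

theorem injective_fderiv_of_jac_ne_zero (hφ : DifferentiableAt ℝ φ q) (hjac : jac φ q ≠ 0) :
    Function.Injective (fderiv ℝ φ q) := fun v w hvw =>
  injective_fderiv_proj hφ hjac (by rw [fderiv_proj_apply hφ, fderiv_proj_apply hφ, hvw])

theorem image_eq_graphOver {f : ℝ × ℝ → ℝ} {V Ω : Set (ℝ × ℝ)} (hproj : proj φ '' V = Ω)
    (hφ : ∀ q ∈ V, φ q 0 = f (proj φ q)) : φ '' V = graphOver f Ω := by
  rw [← hproj, graphOver, Set.image_image]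
  refine Set.image_congr fun q hq => ?_
  rw [← hφ q hq]
  ext j
  fin_cases j <;> rfl

theorem exists_graph_of_jac_ne_zero (hφ : AnalyticAt ℝ φ q) (hjac : jac φ q ≠ 0)
    {W : Set (ℝ × ℝ)} (hW : W ∈ 𝓝 q) :
    ∃ V ⊆ W, IsOpen V ∧ q ∈ V ∧ ∃ (r : ℝ) (f : ℝ × ℝ → ℝ), 0 < r ∧
      proj φ '' V = Metric.ball (proj φ q) r ∧
      AnalyticOnNhd ℝ f (Metric.ball (proj φ q) r) ∧ ∀ w ∈ V, φ w 0 = f (proj φ w) := by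
  obtain ⟨e, he, hq, hsymm⟩ := exists_openPartialHomeomorph (analyticAt_proj hφ).contDiffAt
    (n := ω) (by simp) (injective_fderiv_proj hφ.differentiableAt hjac)
  have hback : e.symm (proj φ q) = q := by rw [← he, e.left_inv hq]
  have htarget : proj φ q ∈ e.target := by simpa only [he] using e.map_source hq
  have hcont : Tendsto e.symm (𝓝 (proj φ q)) (𝓝 q) := by
    simpa only [hback] using hsymm.continuousAt.tendsto
  obtain ⟨r, hr, hball⟩ := Metric.eventually_nhds_iff_ball.1
    ((e.open_target.eventually_mem htarget).and (hsymm.analyticAt.eventually_analyticAt.and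
      ((hcont.eventually hW).and (hcont.eventually hφ.eventually_analyticAt))))
  have hsub : Metric.ball (proj φ q) r ⊆ e.target := fun z hz => (hball z hz).1
  refine ⟨e.symm '' Metric.ball (proj φ q) r, ?_,
    e.symm.isOpen_image_of_subset_source Metric.isOpen_ball hsub,
    ⟨_, Metric.mem_ball_self hr, hback⟩, r, fun z => φ (e.symm z) 0, hr, ?_, ?_, ?_⟩
  · rintro _ ⟨z, hz, rfl⟩
    exact (hball z hz).2.2.1
  · rw [Set.image_image]
    exact (Set.image_congr fun z hz => by rw [← he, e.right_inv (hsub hz), id]).trans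
      (Set.image_id _)
  · exact fun z hz => (analyticAt_pi_iff.1 (hball z hz).2.2.2 0).fun_comp (hball z hz).2.1
  · rintro _ ⟨z, hz, rfl⟩
    simp only [← he, e.right_inv (hsub hz)]

end Projection

section LocalGraph

/-- The second derivative of `f` at `z` along the vector `w`, in terms of partial derivatives. -/
noncomputable def secondDerivAlong (f : ℝ × ℝ → ℝ) (z w : ℝ × ℝ) : ℝ :=
  w.1 * (w.1 * d₁ (d₁ f) z + w.2 * d₂ (d₁ f) z) + w.2 * (w.1 * d₁ (d₂ f) z + w.2 * d₂ (d₂ f) z)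

/-- Near the parameter `q`, the surface `φ` lies on the graph `t = f(x, y)`; no injectivity of
`φ` is asked for. -/
def LiesOnGraph (φ : ℝ × ℝ → Mink) (f : ℝ × ℝ → ℝ) (q : ℝ × ℝ) : Prop :=
  ∀ᶠ w in 𝓝 q, φ w 0 = f (proj φ w)

variable {f : ℝ × ℝ → ℝ}

theorem second_deriv_eq_of_eventually_eq_comp {x y z x' y' z' : ℝ → ℝ} {a b c t : ℝ}
    (hf : AnalyticAt ℝ f (x t, y t)) (hz : ∀ᶠ s in 𝓝 t, z s = f (x s, y s))
    (hx : ∀ᶠ s in 𝓝 t, HasDerivAt x (x' s) s) (hy : ∀ᶠ s in 𝓝 t, HasDerivAt y (y' s) s)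
    (hz' : ∀ᶠ s in 𝓝 t, HasDerivAt z (z' s) s) (hx'' : HasDerivAt x' a t)
    (hy'' : HasDerivAt y' b t) (hz'' : HasDerivAt z' c t) :
    c = a * d₁ f (x t, y t) + b * d₂ f (x t, y t) +
      secondDerivAlong f (x t, y t) (x' t, y' t) := by
  have hcont := hx.self_of_nhds.continuousAt.prodMk hy.self_of_nhds.continuousAt
  have hfirst : ∀ᶠ s in 𝓝 t, z' s = x' s * d₁ f (x s, y s) + y' s * d₂ f (x s, y s) := by
    filter_upwards [hz.eventually_nhds, hx, hy, hz',
      hcont.eventually hf.eventually_analyticAt] with s hs hxs hys hzs hfs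
    exact hzs.unique ((hasDerivAt_comp_pair hfs.differentiableAt hxs hys).congr_of_eventuallyEq hs)
  rw [secondDerivAlong, ← add_assoc]
  exact hz''.unique ((hasDerivAt_second (analyticAt_d₁ hf).differentiableAt
    (analyticAt_d₂ hf).differentiableAt hx.self_of_nhds hy.self_of_nhds hx''
    hy'').congr_of_eventuallyEq hfirst)

namespace LiesOnGraph

variable {φ : ℝ × ℝ → Mink} {q : ℝ × ℝ}

theorem d₁_zero (h : LiesOnGraph φ f q) (hφ : DifferentiableAt ℝ φ q)
    (hf : DifferentiableAt ℝ f (proj φ q)) :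
    d₁ φ q 0 = d₁ φ q 1 * d₁ f (proj φ q) + d₁ φ q 2 * d₂ f (proj φ q) := by
  have hφ₁ := hasDerivAt_pi.1 (hasDerivAt_d₁ hφ)
  exact (hφ₁ 0).unique ((hasDerivAt_comp_pair hf (hφ₁ 1) (hφ₁ 2)).congr_of_eventuallyEq
    (eventually_nhds_fst h))

theorem d₂_zero (h : LiesOnGraph φ f q) (hφ : DifferentiableAt ℝ φ q)
    (hf : DifferentiableAt ℝ f (proj φ q)) :
    d₂ φ q 0 = d₂ φ q 1 * d₁ f (proj φ q) + d₂ φ q 2 * d₂ f (proj φ q) := by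
  have hφ₂ := hasDerivAt_pi.1 (hasDerivAt_d₂ hφ)
  exact (hφ₂ 0).unique ((hasDerivAt_comp_pair hf (hφ₂ 1) (hφ₂ 2)).congr_of_eventuallyEq
    (eventually_nhds_snd h))

theorem d₁_d₁_zero (h : LiesOnGraph φ f q) (hφ : AnalyticAt ℝ φ q)
    (hf : AnalyticAt ℝ f (proj φ q)) :
    d₁ (d₁ φ) q 0 = d₁ (d₁ φ) q 1 * d₁ f (proj φ q) + d₁ (d₁ φ) q 2 * d₂ f (proj φ q) +
      secondDerivAlong f (proj φ q) (d₁ φ q 1, d₁ φ q 2) := by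
  have hfirst (j : Fin 3) :
      ∀ᶠ s in 𝓝 q.1, HasDerivAt (fun t => φ (t, q.2) j) (d₁ φ (s, q.2) j) s :=
    (eventually_nhds_fst hφ.eventually_analyticAt).mono fun s hs =>
      hasDerivAt_pi.1 (hasDerivAt_d₁ hs.differentiableAt) j
  have hsecond := hasDerivAt_pi.1 (hasDerivAt_d₁ (analyticAt_d₁ hφ).differentiableAt)
  exact second_deriv_eq_of_eventually_eq_comp hf (eventually_nhds_fst h) (hfirst 1) (hfirst 2)
    (hfirst 0) (hsecond 1) (hsecond 2) (hsecond 0)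

theorem d₂_d₂_zero (h : LiesOnGraph φ f q) (hφ : AnalyticAt ℝ φ q)
    (hf : AnalyticAt ℝ f (proj φ q)) :
    d₂ (d₂ φ) q 0 = d₂ (d₂ φ) q 1 * d₁ f (proj φ q) + d₂ (d₂ φ) q 2 * d₂ f (proj φ q) +
      secondDerivAlong f (proj φ q) (d₂ φ q 1, d₂ φ q 2) := by
  have hfirst (j : Fin 3) :
      ∀ᶠ s in 𝓝 q.2, HasDerivAt (fun t => φ (q.1, t) j) (d₂ φ (q.1, s) j) s :=
    (eventually_nhds_snd hφ.eventually_analyticAt).mono fun s hs =>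
      hasDerivAt_pi.1 (hasDerivAt_d₂ hs.differentiableAt) j
  have hsecond := hasDerivAt_pi.1 (hasDerivAt_d₂ (analyticAt_d₂ hφ).differentiableAt)
  exact second_deriv_eq_of_eventually_eq_comp hf (eventually_nhds_snd h) (hfirst 1) (hfirst 2)
    (hfirst 0) (hsecond 1) (hsecond 2) (hsecond 0)

end LiesOnGraph

namespace ConformalSystem

variable {φ : ℝ × ℝ → Mink} {q : ℝ × ℝ}

theorem secondDerivAlong_add (h : ConformalSystem φ q) (hgraph : LiesOnGraph φ f q)
    (hφ : AnalyticAt ℝ φ q) (hf : AnalyticAt ℝ f (proj φ q)) :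
    secondDerivAlong f (proj φ q) (d₁ φ q 1, d₁ φ q 2) +
      4 * q.2 * secondDerivAlong f (proj φ q) (d₂ φ q 1, d₂ φ q 2) = 0 := by
  have hwave (j : Fin 3) : d₁ (d₁ φ) q j + 4 * q.2 * d₂ (d₂ φ) q j + 2 * d₂ φ q j = 0 :=
    congrFun h.wave j
  have hwave₀ := hwave 0
  rw [hgraph.d₁_d₁_zero hφ hf, hgraph.d₂_d₂_zero hφ hf,
    hgraph.d₂_zero hφ.differentiableAt hf.differentiableAt] at hwave₀
  linear_combination hwave₀ - d₁ f (proj φ q) * hwave 1 - d₂ f (proj φ q) * hwave 2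

theorem equation_of_liesOnGraph (h : ConformalSystem φ q) (hjac : jac φ q ≠ 0)
    (hgraph : LiesOnGraph φ f q) (hφ : AnalyticAt ℝ φ q) (hf : AnalyticAt ℝ f (proj φ q)) :
    (1 - d₂ f (proj φ q) ^ 2) * d₁ (d₁ f) (proj φ q) +
      2 * d₁ f (proj φ q) * d₂ f (proj φ q) * d₂ (d₁ f) (proj φ q) +
      (1 - d₁ f (proj φ q) ^ 2) * d₂ (d₂ f) (proj φ q) = 0 := by
  have hsecond := h.secondDerivAlong_add hgraph hφ hf
  have hcomm : d₁ (d₂ f) (proj φ q) = d₂ (d₁ f) (proj φ q) := (d₂_d₁_comm hf.contDiffAt).symm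
  have horth := h.orthogonal
  have hconf := h.conformal
  simp only [lorentz, hgraph.d₁_zero hφ.differentiableAt hf.differentiableAt,
    hgraph.d₂_zero hφ.differentiableAt hf.differentiableAt] at horth hconf
  simp only [secondDerivAlong, hcomm] at hsecond
  rw [jac] at hjac
  generalize d₁ f (proj φ q) = a at *
  generalize d₂ f (proj φ q) = b at *
  generalize d₁ (d₁ f) (proj φ q) = r at *
  generalize d₂ (d₁ f) (proj φ q) = s at *
  generalize d₂ (d₂ f) (proj φ q) = t at *
  generalize d₁ φ q 1 = xu at *
  generalize d₁ φ q 2 = yu at *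
  generalize d₂ φ q 1 = xv at *
  generalize d₂ φ q 2 = yv at *
  refine (mul_eq_zero.1 (?_ : (xu * yv - yu * xv) ^ 2 * _ = 0)).resolve_left (pow_ne_zero 2 hjac)
  linear_combination (-(xv * a + yv * b) ^ 2 + xv ^ 2 + yv ^ 2) * hsecond +
    (-2 * (r * xu * xv + s * (xu * yv + xv * yu) + t * yu * yv)) * horth +
    (r * xv ^ 2 + 2 * s * xv * yv + t * yv ^ 2) * hconf

theorem jac_sq_mul_typeFun (h : ConformalSystem φ q) (hgraph : LiesOnGraph φ f q)
    (hφ : DifferentiableAt ℝ φ q) (hf : DifferentiableAt ℝ f (proj φ q)) :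
    jac φ q ^ 2 * typeFun f (proj φ q) = q.2 * (4 * lorentz (d₂ φ q) (d₂ φ q) ^ 2) := by
  have horth := h.orthogonal
  have hconf := h.conformal
  simp only [lorentz, typeFun, jac, hgraph.d₁_zero hφ hf, hgraph.d₂_zero hφ hf]
    at horth hconf ⊢
  generalize d₁ f (proj φ q) = a at *
  generalize d₂ f (proj φ q) = b at *
  generalize d₁ φ q 1 = xu at *
  generalize d₁ φ q 2 = yu at *
  generalize d₂ φ q 1 = xv at *
  generalize d₂ φ q 2 = yv at *
  linear_combination (-(xv * a + yv * b) ^ 2 + xv ^ 2 + yv ^ 2) * hconf -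
    (-((xu * a + yu * b) * (xv * a + yv * b)) + xu * xv + yu * yv) * horth

end ConformalSystem

theorem analyticAt_typeFun {z : ℝ × ℝ} (hf : AnalyticAt ℝ f z) : AnalyticAt ℝ (typeFun f) z :=
  (analyticAt_const.sub ((analyticAt_d₁ hf).pow 2)).sub ((analyticAt_d₂ hf).pow 2)

theorem mul_deriv_eq_of_eventually_mul_eq {k b l : ℝ → ℝ} {b' : ℝ} (hk : DifferentiableAt ℝ k 0)
    (hb : HasDerivAt b b' 0) (hl : DifferentiableAt ℝ l 0) (hzero : b 0 = 0)
    (h : ∀ᶠ t in 𝓝 0, k t * b t = t * l t) : k 0 * b' = l 0 := by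
  have hderiv := (hk.hasDerivAt.mul hb).unique
    (((hasDerivAt_id 0).mul hl.hasDerivAt).congr_of_eventuallyEq h)
  simpa [hzero] using hderiv

theorem isNondegenerateTypeChange_of_conformalSystem {φ : ℝ × ℝ → Mink} {u : ℝ}
    (h : ∀ᶠ q in 𝓝 ((u, 0) : ℝ × ℝ), ConformalSystem φ q) (hjac : jac φ (u, 0) ≠ 0)
    (hlorentz : lorentz (d₂ φ (u, 0)) (d₂ φ (u, 0)) ≠ 0) (hφ : AnalyticAt ℝ φ (u, 0))
    (hf : AnalyticAt ℝ f (proj φ (u, 0))) (hgraph : LiesOnGraph φ f (u, 0)) :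
    IsNondegenerateTypeChange f (proj φ (u, 0)) := by
  have hev : ∀ᶠ q in 𝓝 ((u, 0) : ℝ × ℝ), jac φ q ^ 2 * typeFun f (proj φ q) =
      q.2 * (4 * lorentz (d₂ φ q) (d₂ φ q) ^ 2) := by
    filter_upwards [h, hgraph.eventually_nhds, hφ.eventually_analyticAt,
      (analyticAt_proj hφ).continuousAt.eventually hf.eventually_analyticAt]
      with q hq hgraphq hφq hfq
    exact hq.jac_sq_mul_typeFun hgraphq hφq.differentiableAt hfq.differentiableAt
  have hzero : typeFun f (proj φ (u, 0)) = 0 := by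
    simpa [hjac] using hev.self_of_nhds
  refine ⟨hzero, fun hgrad => hlorentz ?_⟩
  simp only [Prod.mk.injEq] at hgrad
  have hφ₂ := hasDerivAt_pi.1 (hasDerivAt_d₂ hφ.differentiableAt)
  have hB := hasDerivAt_comp_pair (analyticAt_typeFun hf).differentiableAt (hφ₂ 1) (hφ₂ 2)
  have hjac' := (hasDerivAt_d₂ ((analyticAt_jac hφ).pow 2).differentiableAt).differentiableAt
  have hlorentz' := (hasDerivAt_d₂ (((analyticAt_lorentz (analyticAt_d₂ hφ)
    (analyticAt_d₂ hφ)).pow 2).fun_const_smul (c := (4 : ℝ))).differentiableAt).differentiableAt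
  have hderiv := mul_deriv_eq_of_eventually_mul_eq hjac' hB hlorentz' hzero
    (eventually_nhds_snd hev)
  rw [← proj, hgrad.1, hgrad.2] at hderiv
  simpa using hderiv.symm

end LocalGraph

section NullVectors

variable {v w : Mink}

theorem IsLightlike.zero_ne_zero (hv : IsLightlike v) : v 0 ≠ 0 := by
  intro hv₀
  have hself := hv.2
  simp only [lorentz, hv₀] at hself
  have hv₁ : v 1 = 0 := by nlinarith [sq_nonneg (v 1), sq_nonneg (v 2)]
  have hv₂ : v 2 = 0 := by nlinarith [sq_nonneg (v 1), sq_nonneg (v 2)]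
  exact hv.1 (by ext j; fin_cases j <;> simp [hv₀, hv₁, hv₂])

theorem IsLightlike.det_ne_zero (hv : IsLightlike v) (hvw : lorentz v w = 0)
    (hw : ¬ ∃ k : ℝ, w = k • v) : v 1 * w 2 - v 2 * w 1 ≠ 0 := by
  refine fun hdet => hw ⟨w 0 / v 0, ?_⟩
  have hself := hv.2
  have hv₀ := hv.zero_ne_zero
  simp only [lorentz] at hself hvw
  have hw₁ : v 0 * (w 1 * v 0) = v 0 * (w 0 * v 1) := by
    linear_combination (-w 1) * hself + v 1 * hvw - v 2 * hdet
  have hw₂ : v 0 * (w 2 * v 0) = v 0 * (w 0 * v 2) := by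
    linear_combination (-w 2) * hself + v 2 * hvw + v 1 * hdet
  ext j
  rw [Pi.smul_apply, smul_eq_mul, div_mul_eq_mul_div, eq_div_iff hv₀]
  fin_cases j
  · rfl
  · exact mul_left_cancel₀ hv₀ hw₁
  · exact mul_left_cancel₀ hv₀ hw₂

theorem IsLightlike.lorentz_self_ne_zero (hv : IsLightlike v) (hvw : lorentz v w = 0)
    (hw : ¬ ∃ k : ℝ, w = k • v) : lorentz w w ≠ 0 := by
  refine fun hww => hv.det_ne_zero hvw hw (pow_eq_zero_iff two_ne_zero |>.1 ?_)
  have hself := hv.2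
  simp only [lorentz] at hself hvw hww
  linear_combination (w 1 ^ 2 + w 2 ^ 2) * hself + v 0 ^ 2 * hww -
    (v 1 * w 1 + v 2 * w 2 + v 0 * w 0) * hvw

end NullVectors

section DirectPart

variable {I : Set ℝ} {γ : ℝ → Mink} {U : Set ℂ} {Γ : ℂ → Fin 3 → ℂ} {u : ℝ}

theorem IsNondegenerateNullCurve.lorentz_deriv_deriv (hγ : IsNondegenerateNullCurve I γ)
    (hu : u ∈ I) : lorentz (deriv γ u) (deriv (deriv γ) u) = 0 := by
  have hγ' := hasDerivAt_pi.1 (hγ.analytic u hu).deriv.differentiableAt.hasDerivAt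
  have hself := (((hγ' 0).mul (hγ' 0)).neg.add ((hγ' 1).mul (hγ' 1))).add ((hγ' 2).mul (hγ' 2))
  have hzero := hself.unique ((hasDerivAt_const u (0 : ℝ)).congr_of_eventuallyEq (by
    filter_upwards [hγ.isOpen.mem_nhds hu] with t ht using (hγ.null t ht).2))
  simp only [lorentz]
  linear_combination 2⁻¹ * hzero

theorem IsHolomorphicExtension.phiHat_zero (h : IsHolomorphicExtension I γ U Γ) (hu : u ∈ I) :
    phiHat Γ (u, 0) = γ u := by
  have heq := h.phiHat_neg_sq (u := u) (s := 0) (by simpa using hu) (by simpa using hu)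
  simpa [← two_smul ℝ (γ u), smul_smul] using heq

theorem jac_phiHat_ne_zero (hγ : IsNondegenerateNullCurve I γ)
    (h : IsHolomorphicExtension I γ U Γ) (hu : u ∈ I) :
    jac (phiHat Γ) (u, 0) ≠ 0 := by
  have havg := h.isSymmetricAverage_phiHat hγ.analytic hγ.isOpen hu
  have hdet := (hγ.null u hu).det_ne_zero (hγ.lorentz_deriv_deriv hu) (hγ.nondegenerate u hu)
  rw [jac, havg.d₁_eq_deriv, havg.d₂_eq_deriv_deriv]
  simp only [Pi.smul_apply, smul_eq_mul]
  contrapose! hdet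
  linear_combination (-2) * hdet

theorem lorentz_d₂_phiHat_ne_zero (hγ : IsNondegenerateNullCurve I γ)
    (h : IsHolomorphicExtension I γ U Γ) (hu : u ∈ I) :
    lorentz (d₂ (phiHat Γ) (u, 0)) (d₂ (phiHat Γ) (u, 0)) ≠ 0 := by
  have hself := (hγ.null u hu).lorentz_self_ne_zero (hγ.lorentz_deriv_deriv hu)
    (hγ.nondegenerate u hu)
  rw [(h.isSymmetricAverage_phiHat hγ.analytic hγ.isOpen hu).d₂_eq_deriv_deriv,
    lorentz_smul_left, lorentz_smul_right]
  simpa using hself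

/-- The parameters at which the formula for `φ̂_γ` is meaningful, real valued and analytic, and
at which `φ̂_γ` satisfies the conformal system and is transversal to the `t`-axis. -/
structure IsRegularParameter (I : Set ℝ) (U : Set ℂ) (Γ : ℂ → Fin 3 → ℂ) (q : ℝ × ℝ) : Prop where
  mem_domain : q ∈ phiHatDomain I U
  ofReal_phiHat : ∀ j, phiHatC Γ q j = (phiHat Γ q j : ℂ)
  analyticAt : AnalyticAt ℝ (phiHat Γ) q
  conformalSystem : ConformalSystem (phiHat Γ) q
  jac_ne_zero : jac (phiHat Γ) q ≠ 0

theorem eventually_isRegularParameter (hγ : IsNondegenerateNullCurve I γ)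
    (h : IsHolomorphicExtension I γ U Γ) (hu : u ∈ I) :
    ∀ᶠ q in 𝓝 ((u, 0) : ℝ × ℝ), IsRegularParameter I U Γ q := by
  have havg := h.isSymmetricAverage_phiHat hγ.analytic hγ.isOpen hu
  have hnull : ∀ᶠ t in 𝓝 u, lorentz (deriv γ t) (deriv γ t) = 0 := by
    filter_upwards [hγ.isOpen.mem_nhds hu] with t ht using (hγ.null t ht).2
  filter_upwards [h.eventually_mem_phiHatDomain hγ.isOpen hu,
    eventually_phiHatC_eq_ofReal_phiHat h hγ.isOpen hu, havg.analyticAt.eventually_analyticAt,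
    havg.eventually_conformalSystem hnull,
    (analyticAt_jac havg.analyticAt).continuousAt.eventually_ne (jac_phiHat_ne_zero hγ h hu)]
    with q hdomain hreal hφ hsystem hjac
  exact ⟨hdomain, hreal, hφ, hsystem, hjac⟩

theorem isNondegenerateTypeChangeOfSurface_phiHat (hγ : IsNondegenerateNullCurve I γ)
    (h : IsHolomorphicExtension I γ U Γ) (hu : u ∈ I) :
    IsNondegenerateTypeChangeOfSurface (interior {q | IsRegularParameter I U Γ q})
      (phiHat Γ) (u, 0) := by
  have hreg := eventually_isRegularParameter hγ h hu
  have hφ := hreg.self_of_nhds.analyticAt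
  have hjac := hreg.self_of_nhds.jac_ne_zero
  obtain ⟨V, hVW, hV, huV, r, f, hr, hproj, hf, hgraph⟩ :=
    exists_graph_of_jac_ne_zero hφ hjac (interior_mem_nhds.2 hreg)
  have hlies : ∀ q ∈ V, LiesOnGraph (phiHat Γ) f q := fun q hq =>
    (hV.eventually_mem hq).mono hgraph
  refine ⟨V, hVW, hV, huV, Metric.ball (proj (phiHat Γ) (u, 0)) r, f, ⟨Metric.isOpen_ball,
    Metric.isConnected_ball hr, hf.contDiffOn Metric.isOpen_ball.uniqueDiffOn, ?_⟩, hf,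
    image_eq_graphOver hproj hgraph, ?_⟩
  · intro z hz
    obtain ⟨q, hq, rfl⟩ := hproj.superset hz
    have hregq : IsRegularParameter I U Γ q := interior_subset (hVW hq)
    exact hregq.conformalSystem.equation_of_liesOnGraph hregq.jac_ne_zero (hlies q hq)
      hregq.analyticAt (hf _ hz)
  · exact isNondegenerateTypeChange_of_conformalSystem (hreg.mono fun q hq => hq.conformalSystem)
      hjac (lorentz_d₂_phiHat_ne_zero hγ h hu) hφ (hf _ (Metric.mem_ball_self hr)) (hlies _ huV)

theorem exists_analyticZMCImmersion (hγ : IsNondegenerateNullCurve I γ)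
    (h : IsHolomorphicExtension I γ U Γ) :
    ∃ W : Set (ℝ × ℝ), IsOpen W ∧ (∀ u ∈ I, (u, (0 : ℝ)) ∈ W) ∧ W ⊆ phiHatDomain I U ∧
      (∀ q ∈ W, ∀ j, phiHatC Γ q j = (phiHat Γ q j : ℂ)) ∧
      IsAnalyticZMCImmersion W (phiHat Γ) ∧
      ∀ u ∈ I, phiHat Γ (u, 0) = γ u ∧
        IsNondegenerateTypeChangeOfSurface W (phiHat Γ) (u, 0) := by
  have hreg : ∀ q ∈ interior {q | IsRegularParameter I U Γ q}, IsRegularParameter I U Γ q :=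
    fun q hq => interior_subset hq
  refine ⟨interior {q | IsRegularParameter I U Γ q}, isOpen_interior,
    fun u hu => mem_interior_iff_mem_nhds.2 (eventually_isRegularParameter hγ h hu),
    fun q hq => (hreg q hq).mem_domain, fun q hq => (hreg q hq).ofReal_phiHat, ?_,
    fun u hu => ⟨h.phiHat_zero hu, isNondegenerateTypeChangeOfSurface_phiHat hγ h hu⟩⟩
  exact {
    isOpen := isOpen_interior
    analytic := fun q hq => (hreg q hq).analyticAt
    immersion := fun q hq => injective_fderiv_of_jac_ne_zero
      (hreg q hq).analyticAt.differentiableAt (hreg q hq).jac_ne_zero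
    zero_mean_curvature := fun q hq => (hreg q hq).conformalSystem.meanCurvatureNumerator_eq_zero }

end DirectPart

/-- The gradient of `f`, as a map of the plane into itself; `∇f` of length one is where the type of
the graph changes. -/
noncomputable def grad (f : ℝ × ℝ → ℝ) (z : ℝ × ℝ) : ℝ × ℝ := (d₁ f z, d₂ f z)

section Gradient

variable {f : ℝ × ℝ → ℝ} {z : ℝ × ℝ}

theorem contDiffAt_grad {m n : WithTop ℕ∞} (hf : ContDiffAt ℝ n f z) (hmn : m + 1 ≤ n) :
    ContDiffAt ℝ m (grad f) z :=
  (contDiffAt_d₁ hf hmn).prodMk (contDiffAt_d₂ hf hmn)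

theorem fderiv_grad (hf : ContDiffAt ℝ 2 f z) (w : ℝ × ℝ) :
    fderiv ℝ (grad f) z w = (w.1 * d₁ (d₁ f) z + w.2 * d₂ (d₁ f) z,
      w.1 * d₂ (d₁ f) z + w.2 * d₂ (d₂ f) z) := by
  have h : HasFDerivAt (grad f) _ z :=
    (differentiableAt_d₁ hf).hasFDerivAt.prodMk (differentiableAt_d₂ hf).hasFDerivAt
  rw [h.fderiv, ContinuousLinearMap.prod_apply, fderiv_apply_eq_d₁_add_d₂,
    fderiv_apply_eq_d₁_add_d₂, ← d₂_d₁_comm hf]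
  rfl

theorem fderiv_typeFun (hf : ContDiffAt ℝ 2 f z) (w : ℝ × ℝ) :
    fderiv ℝ (typeFun f) z w =
      -2 * (d₁ f z * (fderiv ℝ (grad f) z w).1 + d₂ f z * (fderiv ℝ (grad f) z w).2) := by
  have h₁ := (differentiableAt_d₁ hf).hasFDerivAt
  have h₂ := (differentiableAt_d₂ hf).hasFDerivAt
  have hB : HasFDerivAt (typeFun f) _ z :=
    ((hasFDerivAt_const (1 : ℝ) z).sub (h₁.pow 2)).sub (h₂.pow 2)
  have hG : HasFDerivAt (grad f) _ z := h₁.prodMk h₂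
  rw [hB.fderiv, hG.fderiv]
  simp only [sub_apply, smul_apply,
    ContinuousLinearMap.prod_apply, zero_apply, smul_eq_mul, nsmul_eq_mul]
  norm_num
  ring

/-- The point is that `B = 0` and the equation force `Hess f` to map the unit vector `(a, b)` to a
non-zero multiple of `(-b, a)`. -/
theorem eq_zero_of_symm_mulVec_eq_zero {a b r s t x y : ℝ} (hunit : a ^ 2 + b ^ 2 = 1)
    (horth : a * (a * r + b * s) + b * (a * s + b * t) = 0)
    (hne : ¬(a * r + b * s = 0 ∧ a * s + b * t = 0))
    (h₁ : x * r + y * s = 0) (h₂ : x * s + y * t = 0) : x = 0 ∧ y = 0 := by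
  obtain ⟨l, hl⟩ : ∃ l, l = a * (a * s + b * t) - b * (a * r + b * s) := ⟨_, rfl⟩
  have hr : a * r + b * s = -b * l := by
    rw [hl]
    linear_combination a * horth - (a * r + b * s) * hunit
  have ht : a * s + b * t = a * l := by
    rw [hl]
    linear_combination b * horth - (a * s + b * t) * hunit
  have hl0 : l ≠ 0 := fun h0 => hne ⟨by rw [hr, h0, mul_zero], by rw [ht, h0, mul_zero]⟩
  have hperp : a * y - b * x = 0 := (mul_eq_zero.1 (show l * (a * y - b * x) = 0 by
    linear_combination a * h₁ + b * h₂ - x * hr - y * ht)).resolve_left hl0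
  have hx : x = a * (a * x + b * y) := by linear_combination -b * hperp - x * hunit
  have hy : y = b * (a * x + b * y) := by linear_combination a * hperp - y * hunit
  have hpar : a * x + b * y = 0 := (mul_eq_zero.1 (show l * (a * x + b * y) = 0 by
    linear_combination (a * x + b * y) * hl + a * (h₂ - s * hx - t * hy)
      - b * (h₁ - r * hx - s * hy))).resolve_left hl0
  exact ⟨by rw [hx, hpar, mul_zero], by rw [hy, hpar, mul_zero]⟩

theorem IsNondegenerateTypeChange.injective_fderiv_grad (hz : IsNondegenerateTypeChange f z)
    (hf : ContDiffAt ℝ 2 f z)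
    (heq : (1 - d₂ f z ^ 2) * d₁ (d₁ f) z + 2 * d₁ f z * d₂ f z * d₂ (d₁ f) z
      + (1 - d₁ f z ^ 2) * d₂ (d₂ f) z = 0) :
    Function.Injective (fderiv ℝ (grad f) z) := by
  obtain ⟨hB, hdB⟩ := hz
  rw [typeFun] at hB
  rw [injective_iff_map_eq_zero]
  intro w hw
  rw [fderiv_grad hf, Prod.mk_eq_zero] at hw
  refine Prod.ext_iff.2 (eq_zero_of_symm_mulVec_eq_zero (a := d₁ f z) (b := d₂ f z)
    (by linear_combination -hB) ?_ ?_ hw.1 hw.2)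
  · linear_combination heq - (d₁ (d₁ f) z + d₂ (d₂ f) z) * hB
  · rintro ⟨h₁, h₂⟩
    refine hdB (Prod.ext ?_ ?_)
    · rw [d₁, fderiv_typeFun hf, fderiv_grad hf]
      linear_combination -2 * h₁
    · rw [d₂, fderiv_typeFun hf, fderiv_grad hf]
      linear_combination -2 * h₂

end Gradient

section Frame

/-- The component of `w` in the direction `(cos θ, sin θ)`. -/
noncomputable def radialPart (θ : ℝ) (w : ℝ × ℝ) : ℝ := w.1 * Real.cos θ + w.2 * Real.sin θ

/-- The component of `w` in the direction `(-sin θ, cos θ)`. -/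
noncomputable def angularPart (θ : ℝ) (w : ℝ × ℝ) : ℝ := w.2 * Real.cos θ - w.1 * Real.sin θ

variable {θ s : ℝ} {v : ℝ → ℝ × ℝ} {v' w : ℝ × ℝ}

theorem fst_eq_radialPart_sub_angularPart (θ : ℝ) (w : ℝ × ℝ) :
    w.1 = radialPart θ w * Real.cos θ - angularPart θ w * Real.sin θ := by
  rw [radialPart, angularPart]
  linear_combination -w.1 * Real.sin_sq_add_cos_sq θ

theorem snd_eq_radialPart_add_angularPart (θ : ℝ) (w : ℝ × ℝ) :
    w.2 = radialPart θ w * Real.sin θ + angularPart θ w * Real.cos θ := by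
  rw [radialPart, angularPart]
  linear_combination -w.2 * Real.sin_sq_add_cos_sq θ

theorem eq_zero_of_radialPart_of_angularPart (hr : radialPart θ w = 0)
    (ha : angularPart θ w = 0) : w = 0 := by
  refine Prod.ext ?_ ?_
  · rw [fst_eq_radialPart_sub_angularPart θ w, hr, ha]
    simp
  · rw [snd_eq_radialPart_add_angularPart θ w, hr, ha]
    simp

theorem radialPart_add_smul (θ c : ℝ) (v w : ℝ × ℝ) :
    radialPart θ (v + c • w) = radialPart θ v + c * radialPart θ w := by
  simp only [radialPart, Prod.fst_add, Prod.snd_add, Prod.smul_fst, Prod.smul_snd, smul_eq_mul]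
  ring

theorem angularPart_add_smul (θ c : ℝ) (v w : ℝ × ℝ) :
    angularPart θ (v + c • w) = angularPart θ v + c * angularPart θ w := by
  simp only [angularPart, Prod.fst_add, Prod.snd_add, Prod.smul_fst, Prod.smul_snd, smul_eq_mul]
  ring

theorem hasDerivAt_radialPart_const (hv : HasDerivAt v v' s) :
    HasDerivAt (fun t => radialPart θ (v t)) (radialPart θ v') s := by
  have h₁ : HasDerivAt (fun t => (v t).1) v'.1 s := hv.fst
  have h₂ : HasDerivAt (fun t => (v t).2) v'.2 s := hv.snd
  exact (h₁.mul_const _).add (h₂.mul_const _)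

theorem hasDerivAt_angularPart_const (hv : HasDerivAt v v' s) :
    HasDerivAt (fun t => angularPart θ (v t)) (angularPart θ v') s := by
  have h₁ : HasDerivAt (fun t => (v t).1) v'.1 s := hv.fst
  have h₂ : HasDerivAt (fun t => (v t).2) v'.2 s := hv.snd
  exact (h₂.mul_const _).sub (h₁.mul_const _)

theorem hasDerivAt_radialPart (hv : HasDerivAt v v' s) :
    HasDerivAt (fun t => radialPart t (v t)) (radialPart s v' + angularPart s (v s)) s := by
  have h₁ : HasDerivAt (fun t => (v t).1) v'.1 s := hv.fst
  have h₂ : HasDerivAt (fun t => (v t).2) v'.2 s := hv.snd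
  refine ((h₁.mul (Real.hasDerivAt_cos s)).add (h₂.mul (Real.hasDerivAt_sin s))).congr_deriv ?_
  rw [radialPart, angularPart]
  ring

theorem hasDerivAt_angularPart (hv : HasDerivAt v v' s) :
    HasDerivAt (fun t => angularPart t (v t)) (angularPart s v' - radialPart s (v s)) s := by
  have h₁ : HasDerivAt (fun t => (v t).1) v'.1 s := hv.fst
  have h₂ : HasDerivAt (fun t => (v t).2) v'.2 s := hv.snd
  refine ((h₂.mul (Real.hasDerivAt_cos s)).sub (h₁.mul (Real.hasDerivAt_sin s))).congr_deriv ?_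
  rw [radialPart, angularPart]
  ring

end Frame

section Profile

/-- A profile `ρ` for which the conformal type of the surface is standard in the coordinates
`(θ, s) ↦ ρ s (cos θ, sin θ)` of the gradient plane, together with `k = -ρ' / ρ`. The sign `ε` is
`1` on the space-like side `ρ ≤ 1` and `-1` on the time-like side `ρ ≥ 1`. -/
structure IsRadialProfile (ε : ℝ) (ρ k : ℝ → ℝ) (s : ℝ) : Prop where
  hasDerivAt : HasDerivAt ρ (-k s * ρ s) s
  hasDerivAt_logDeriv : HasDerivAt k (ε - k s ^ 2) s
  sq_eq_one : ε ^ 2 = 1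
  mul_sq_eq : ε * k s ^ 2 = 1 - ρ s ^ 2
  ne_zero : ρ s ≠ 0
  logDeriv_ne_zero : s ≠ 0 → k s ≠ 0
  contDiffAt : ContDiffAt ℝ 2 ρ s

theorem IsRadialProfile.logDeriv_eq_zero {ε s : ℝ} {ρ k : ℝ → ℝ} (h : IsRadialProfile ε ρ k s)
    (hρ : ρ s = 1) : k s = 0 := by
  refine pow_eq_zero_iff two_ne_zero |>.1 ?_
  linear_combination ε * h.mul_sq_eq - k s ^ 2 * h.sq_eq_one - ε * (1 + ρ s) * hρ

/-- The radial profile `1 / cosh`, used on the space-like side. -/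
noncomputable def sechProfile (s : ℝ) : ℝ := (Real.cosh s)⁻¹

/-- The radial profile `1 / cos`, used on the time-like side. -/
noncomputable def secProfile (s : ℝ) : ℝ := (Real.cos s)⁻¹

@[simp]
theorem sechProfile_zero : sechProfile 0 = 1 := by simp [sechProfile]

@[simp]
theorem secProfile_zero : secProfile 0 = 1 := by simp [secProfile]

theorem isRadialProfile_sech (s : ℝ) : IsRadialProfile 1 sechProfile Real.tanh s := by
  have htanh : Real.tanh = fun s => Real.sinh s / Real.cosh s :=
    funext Real.tanh_eq_sinh_div_cosh
  have hc := (Real.cosh_pos s).ne'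
  rw [htanh]
  refine ⟨((Real.hasDerivAt_cosh s).fun_inv hc).congr_deriv ?_,
    ((Real.hasDerivAt_sinh s).fun_div (Real.hasDerivAt_cosh s) hc).congr_deriv ?_,
    one_pow 2, ?_, inv_ne_zero hc, fun h => by simpa [hc] using h,
    Real.contDiff_cosh.contDiffAt.inv hc⟩
  · rw [sechProfile]
    field_simp
  · field_simp
  · rw [sechProfile]
    field_simp
    rw [Real.cosh_sq]
    ring

theorem isRadialProfile_sec {s : ℝ} (hs : |s| < Real.pi / 2) :
    IsRadialProfile (-1) secProfile (fun s => -Real.tan s) s := by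
  have htan : (fun s => -Real.tan s) = fun s => -(Real.sin s / Real.cos s) :=
    funext fun s => by rw [Real.tan_eq_sin_div_cos]
  obtain ⟨hs₁, hs₂⟩ := abs_lt.1 hs
  have hc : Real.cos s ≠ 0 := (Real.cos_pos_of_mem_Ioo ⟨hs₁, hs₂⟩).ne'
  rw [htan]
  refine ⟨((Real.hasDerivAt_cos s).fun_inv hc).congr_deriv ?_,
    ((Real.hasDerivAt_sin s).fun_div (Real.hasDerivAt_cos s) hc).fun_neg.congr_deriv ?_,
    by norm_num, ?_, inv_ne_zero hc, fun h => neg_ne_zero.2 (div_ne_zero (fun h0 => h ?_) hc),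
    Real.contDiff_cos.contDiffAt.inv hc⟩
  · rw [secProfile]
    field_simp
  · field_simp
    ring
  · rw [secProfile]
    field_simp
    rw [Real.sin_sq]
    ring
  · exact (Real.sin_eq_zero_iff_of_lt_of_lt (by linarith) (by linarith)).1 h0

end Profile

/-- Polar coordinates with radial profile `ρ`; the first variable is the angle. -/
noncomputable def polar (ρ : ℝ → ℝ) (q : ℝ × ℝ) : ℝ × ℝ :=
  (ρ q.2 * Real.cos q.1, ρ q.2 * Real.sin q.1)

section Polar

variable {ρ : ℝ → ℝ} {q : ℝ × ℝ}

theorem contDiffAt_polar {n : WithTop ℕ∞} (h : ContDiffAt ℝ n ρ q.2) :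
    ContDiffAt ℝ n (polar ρ) q := by
  have hρ : ContDiffAt ℝ n (fun q : ℝ × ℝ => ρ q.2) q := h.comp q contDiffAt_snd
  exact (hρ.mul contDiffAt_fst.cos).prodMk (hρ.mul contDiffAt_fst.sin)

theorem hasDerivAt_polar_fst (ρ : ℝ → ℝ) (q : ℝ × ℝ) :
    HasDerivAt (fun t => polar ρ (t, q.2)) (-(ρ q.2 * Real.sin q.1), ρ q.2 * Real.cos q.1) q.1 :=
  (((Real.hasDerivAt_cos q.1).const_mul (ρ q.2)).congr_deriv (mul_neg _ _)).prodMk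
    ((Real.hasDerivAt_sin q.1).const_mul (ρ q.2))

theorem hasDerivAt_polar_snd {ρ' : ℝ} (hρ : HasDerivAt ρ ρ' q.2) :
    HasDerivAt (fun s => polar ρ (q.1, s)) (ρ' * Real.cos q.1, ρ' * Real.sin q.1) q.2 :=
  (hρ.mul_const (Real.cos q.1)).prodMk (hρ.mul_const (Real.sin q.1))

end Polar

/-- `g` is a `C²` solution of `g_ss + ε g_θθ = 0` at the point `q = (θ, s)`: the Laplace equation
for `ε = 1`, the wave equation for `ε = -1`. -/
structure IsWaveSolutionAt {E : Type*} [NormedAddCommGroup E] [NormedSpace ℝ E] (ε : ℝ)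
    (g : ℝ × ℝ → E) (q : ℝ × ℝ) : Prop where
  contDiffAt : ContDiffAt ℝ 2 g q
  equation : d₂ (d₂ g) q + ε • d₁ (d₁ g) q = 0

section WaveSolution

variable {E F : Type*} [NormedAddCommGroup E] [NormedSpace ℝ E] [NormedAddCommGroup F]
  [NormedSpace ℝ F] {g : ℝ × ℝ → E} {q : ℝ × ℝ} {ε : ℝ}

theorem d₁_comp {G : E → F} (hG : DifferentiableAt ℝ G (g q)) (hg : DifferentiableAt ℝ g q) :
    d₁ (fun w => G (g w)) q = fderiv ℝ G (g q) (d₁ g q) :=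
  DFunLike.congr_fun (fderiv_comp q hG hg) (1, 0)

theorem d₂_comp {G : E → F} (hG : DifferentiableAt ℝ G (g q)) (hg : DifferentiableAt ℝ g q) :
    d₂ (fun w => G (g w)) q = fderiv ℝ G (g q) (d₂ g q) :=
  DFunLike.congr_fun (fderiv_comp q hG hg) (0, 1)

theorem d₁_clm_comp (L : E →L[ℝ] F) (hg : DifferentiableAt ℝ g q) :
    d₁ (fun w => L (g w)) q = L (d₁ g q) := by
  rw [d₁_comp L.differentiableAt hg, L.fderiv]

theorem d₂_clm_comp (L : E →L[ℝ] F) (hg : DifferentiableAt ℝ g q) :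
    d₂ (fun w => L (g w)) q = L (d₂ g q) := by
  rw [d₂_comp L.differentiableAt hg, L.fderiv]

theorem IsWaveSolutionAt.clm_comp (L : E →L[ℝ] F) (h : IsWaveSolutionAt ε g q) :
    IsWaveSolutionAt ε (fun w => L (g w)) q := by
  have hdiff : ∀ᶠ w in 𝓝 q, DifferentiableAt ℝ g w :=
    (h.contDiffAt.eventually (by decide)).mono fun w hw => hw.differentiableAt two_ne_zero
  refine ⟨L.contDiff.contDiffAt.comp q h.contDiffAt, ?_⟩
  rw [d₁_congr (hdiff.mono fun w hw => d₁_clm_comp L hw),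
    d₂_congr (hdiff.mono fun w hw => d₂_clm_comp L hw),
    d₁_clm_comp L (differentiableAt_d₁ h.contDiffAt),
    d₂_clm_comp L (differentiableAt_d₂ h.contDiffAt), ← map_smul, ← map_add, h.equation, map_zero]

end WaveSolution

theorem eq_zero_of_eventually_ne {E : Type*} [TopologicalSpace E] [Zero E] [T2Space E]
    {G : ℝ × ℝ → E} {q : ℝ × ℝ} (hG : ContinuousAt G q)
    (h : ∀ᶠ w in 𝓝 q, w.2 ≠ 0 → G w = 0) : G q = 0 := by
  by_cases hq : q.2 = 0
  · have hline : Tendsto (fun s : ℝ => (q.1, s)) (𝓝[≠] q.2) (𝓝 q) :=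
      (Continuous.prodMk_right q.1).continuousAt.mono_left nhdsWithin_le_nhds
    refine tendsto_nhds_unique (hG.tendsto.comp hline) (tendsto_const_nhds.congr' ?_)
    filter_upwards [hline.eventually h, self_mem_nhdsWithin] with s hs hs0
    exact (hs (hq ▸ hs0)).symm
  · exact h.self_of_nhds hq

/-- `X` inverts the gradient of the solution `f` in polar coordinates: `q = (θ, s)` is mapped to a
point at which `∇f = ρ s (cos θ, sin θ)` (the hodograph transformation). -/
structure IsHodographAt (f : ℝ × ℝ → ℝ) (X : ℝ × ℝ → ℝ × ℝ) (ε : ℝ) (ρ k : ℝ → ℝ) (q : ℝ × ℝ) :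
    Prop where
  profile : IsRadialProfile ε ρ k q.2
  contDiffAt : ContDiffAt ℝ 2 X q
  contDiffAt_base : ContDiffAt ℝ 2 f (X q)
  equation : (1 - d₂ f (X q) ^ 2) * d₁ (d₁ f) (X q)
    + 2 * d₁ f (X q) * d₂ f (X q) * d₂ (d₁ f) (X q)
    + (1 - d₁ f (X q) ^ 2) * d₂ (d₂ f) (X q) = 0
  grad_eq : grad f (X q) = polar ρ q

/-- The zero mean curvature equation in hodograph coordinates, written in the frame
`(cos θ, sin θ)`, `(-sin θ, cos θ)`. -/
structure HodographSystem (ε : ℝ) (k : ℝ → ℝ) (X : ℝ × ℝ → ℝ × ℝ) (q : ℝ × ℝ) : Prop where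
  radial : angularPart q.1 (d₂ X q) + k q.2 * radialPart q.1 (d₁ X q) = 0
  angular : angularPart q.1 (d₁ X q) - ε * k q.2 * radialPart q.1 (d₂ X q) = 0

section Algebra

theorem exists_frame_hessian {f : ℝ × ℝ → ℝ} {z : ℝ × ℝ} {ε κ r θ : ℝ} (hf : ContDiffAt ℝ 2 f z)
    (heq : (1 - d₂ f z ^ 2) * d₁ (d₁ f) z + 2 * d₁ f z * d₂ f z * d₂ (d₁ f) z
      + (1 - d₁ f z ^ 2) * d₂ (d₂ f) z = 0)
    (hgrad : grad f z = (r * Real.cos θ, r * Real.sin θ)) (hκ : ε * κ ^ 2 = 1 - r ^ 2) :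
    ∃ a b c, a + ε * κ ^ 2 * c = 0 ∧ ∀ w,
      radialPart θ (fderiv ℝ (grad f) z w) = a * radialPart θ w + b * angularPart θ w ∧
      angularPart θ (fderiv ℝ (grad f) z w) = b * radialPart θ w + c * angularPart θ w := by
  have h₁ : d₁ f z = r * Real.cos θ := congrArg Prod.fst hgrad
  have h₂ : d₂ f z = r * Real.sin θ := congrArg Prod.snd hgrad
  have hpyth := Real.sin_sq_add_cos_sq θ
  rw [h₁, h₂] at heq
  refine ⟨d₁ (d₁ f) z * Real.cos θ ^ 2 + 2 * d₂ (d₁ f) z * Real.sin θ * Real.cos θ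
      + d₂ (d₂ f) z * Real.sin θ ^ 2,
    (d₂ (d₂ f) z - d₁ (d₁ f) z) * Real.sin θ * Real.cos θ
      + d₂ (d₁ f) z * (Real.cos θ ^ 2 - Real.sin θ ^ 2),
    d₁ (d₁ f) z * Real.sin θ ^ 2 - 2 * d₂ (d₁ f) z * Real.sin θ * Real.cos θ
      + d₂ (d₂ f) z * Real.cos θ ^ 2, ?_, fun w => ?_⟩
  · rw [hκ]
    linear_combination heq + (d₁ (d₁ f) z + d₂ (d₂ f) z) * hpyth
  · rw [fderiv_grad hf]
    simp only [radialPart, angularPart]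
    constructor
    · linear_combination -((w.1 * d₁ (d₁ f) z + w.2 * d₂ (d₁ f) z) * Real.cos θ
        + (w.1 * d₂ (d₁ f) z + w.2 * d₂ (d₂ f) z) * Real.sin θ) * hpyth
    · linear_combination -((w.1 * d₂ (d₁ f) z + w.2 * d₂ (d₂ f) z) * Real.cos θ
        - (w.1 * d₁ (d₁ f) z + w.2 * d₂ (d₁ f) z) * Real.sin θ) * hpyth

/-- With `H = !![a, b; b, c]`, the hypotheses say `H x = (-κ r, 0)` and `H y = (0, r)`. -/
theorem hodograph_system_of_hessian {a b c ε κ r x₁ x₂ y₁ y₂ : ℝ}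
    (hx₁ : a * x₁ + b * x₂ = -κ * r) (hx₂ : b * x₁ + c * x₂ = 0)
    (hy₁ : a * y₁ + b * y₂ = 0) (hy₂ : b * y₁ + c * y₂ = r)
    (htrace : a + ε * κ ^ 2 * c = 0) (hr : r ≠ 0) (hκ : κ ≠ 0) :
    x₂ + κ * y₁ = 0 ∧ y₂ - ε * κ * x₁ = 0 := by
  have hsymm : x₂ + κ * y₁ = 0 := (mul_eq_zero.1 (show r * (x₂ + κ * y₁) = 0 by
    linear_combination y₁ * hx₁ + y₂ * hx₂ - x₁ * hy₁ - x₂ * hy₂)).resolve_left hr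
  refine ⟨hsymm, (mul_eq_zero.1 (?_ : r * (y₂ - ε * κ * x₁) = 0)).resolve_left hr⟩
  have hb : b * (y₂ - ε * κ * x₁) = 0 := by
    linear_combination hy₁ - y₁ * htrace - ε * κ * hx₂ + ε * κ * c * hsymm
  have hc : c * (y₂ - ε * κ * x₁) = 0 := (mul_eq_zero.1 (show κ * (c * (y₂ - ε * κ * x₁)) = 0 by
    linear_combination κ * hy₂ - b * hsymm + hx₁ - x₁ * htrace)).resolve_left hκ
  linear_combination y₁ * hb + y₂ * hc - (y₂ - ε * κ * x₁) * hy₂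

end Algebra

/-- The point of the graph of `f` over `z`. -/
def graphPoint (f : ℝ × ℝ → ℝ) (z : ℝ × ℝ) : Mink := ![f z, z.1, z.2]

section Hodograph

variable {f : ℝ × ℝ → ℝ} {X : ℝ × ℝ → ℝ × ℝ} {ε : ℝ} {ρ k : ℝ → ℝ} {q : ℝ × ℝ}

theorem continuousAt_radialPart {v : ℝ × ℝ → ℝ × ℝ} (hv : ContinuousAt v q) :
    ContinuousAt (fun w => radialPart w.1 (v w)) q := by
  unfold radialPart
  fun_prop

theorem continuousAt_angularPart {v : ℝ × ℝ → ℝ × ℝ} (hv : ContinuousAt v q) :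
    ContinuousAt (fun w => angularPart w.1 (v w)) q := by
  unfold angularPart
  fun_prop

theorem fderiv_grad_d₁ (h : ∀ᶠ w in 𝓝 q, IsHodographAt f X ε ρ k w) :
    fderiv ℝ (grad f) (X q) (d₁ X q) = (-(ρ q.2 * Real.sin q.1), ρ q.2 * Real.cos q.1) := by
  obtain ⟨hρ, hX, hf, -, -⟩ := h.self_of_nhds
  rw [← d₁_comp ((contDiffAt_grad hf (by norm_num)).differentiableAt one_ne_zero)
    (hX.differentiableAt two_ne_zero), d₁_congr (h.mono fun w hw => hw.grad_eq)]
  exact (hasDerivAt_d₁ ((contDiffAt_polar hρ.contDiffAt).differentiableAt two_ne_zero)).unique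
    (hasDerivAt_polar_fst ρ q)

theorem fderiv_grad_d₂ (h : ∀ᶠ w in 𝓝 q, IsHodographAt f X ε ρ k w) :
    fderiv ℝ (grad f) (X q) (d₂ X q) =
      (-k q.2 * ρ q.2 * Real.cos q.1, -k q.2 * ρ q.2 * Real.sin q.1) := by
  obtain ⟨hρ, hX, hf, -, -⟩ := h.self_of_nhds
  rw [← d₂_comp ((contDiffAt_grad hf (by norm_num)).differentiableAt one_ne_zero)
    (hX.differentiableAt two_ne_zero), d₂_congr (h.mono fun w hw => hw.grad_eq)]
  exact (hasDerivAt_d₂ ((contDiffAt_polar hρ.contDiffAt).differentiableAt two_ne_zero)).unique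
    (hasDerivAt_polar_snd hρ.hasDerivAt)

/-- Here `!![a, b; b, c]` is the Hessian of `f` at `X q` in the frame of `HodographSystem`. -/
theorem exists_frame_hessian_hodograph (h : ∀ᶠ w in 𝓝 q, IsHodographAt f X ε ρ k w) :
    ∃ a b c, a + ε * k q.2 ^ 2 * c = 0 ∧
      a * radialPart q.1 (d₂ X q) + b * angularPart q.1 (d₂ X q) = -k q.2 * ρ q.2 ∧
      b * radialPart q.1 (d₂ X q) + c * angularPart q.1 (d₂ X q) = 0 ∧
      a * radialPart q.1 (d₁ X q) + b * angularPart q.1 (d₁ X q) = 0 ∧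
      b * radialPart q.1 (d₁ X q) + c * angularPart q.1 (d₁ X q) = ρ q.2 := by
  obtain ⟨hρ, -, hf, heq, hgrad⟩ := h.self_of_nhds
  obtain ⟨a, b, c, habc, hH⟩ := exists_frame_hessian hf heq hgrad hρ.mul_sq_eq
  have hpyth := Real.sin_sq_add_cos_sq q.1
  refine ⟨a, b, c, habc, ?_, ?_, ?_, ?_⟩
  · rw [← (hH _).1, fderiv_grad_d₂ h, radialPart]
    linear_combination -k q.2 * ρ q.2 * hpyth
  · rw [← (hH _).2, fderiv_grad_d₂ h, angularPart]
    ring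
  · rw [← (hH _).1, fderiv_grad_d₁ h, radialPart]
    ring
  · rw [← (hH _).2, fderiv_grad_d₁ h, angularPart]
    linear_combination ρ q.2 * hpyth

theorem hodographSystem (h : ∀ᶠ w in 𝓝 q, IsHodographAt f X ε ρ k w) :
    HodographSystem ε k X q := by
  obtain ⟨hρ, hX, -, -, -⟩ := h.self_of_nhds
  have hk : ContinuousAt (fun w : ℝ × ℝ => k w.2) q :=
    hρ.hasDerivAt_logDeriv.continuousAt.comp continuousAt_snd
  have h₁ := (differentiableAt_d₁ hX).continuousAt
  have h₂ := (differentiableAt_d₂ hX).continuousAt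
  have hne : ∀ᶠ w in 𝓝 q, w.2 ≠ 0 → HodographSystem ε k X w :=
    h.eventually_nhds.mono fun w hw hw0 => by
      have hρw := hw.self_of_nhds.profile
      obtain ⟨a, b, c, habc, hx₁, hx₂, hy₁, hy₂⟩ := exists_frame_hessian_hodograph hw
      have hsys := hodograph_system_of_hessian hx₁ hx₂ hy₁ hy₂ habc hρw.ne_zero
        (hρw.logDeriv_ne_zero hw0)
      exact ⟨hsys.1, hsys.2⟩
  exact ⟨eq_zero_of_eventually_ne
      ((continuousAt_angularPart h₂).add (hk.mul (continuousAt_radialPart h₁)))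
      (hne.mono fun w hw hw0 => (hw hw0).radial),
    eq_zero_of_eventually_ne ((continuousAt_angularPart h₁).sub
      ((continuousAt_const.mul hk).mul (continuousAt_radialPart h₂)))
      (hne.mono fun w hw hw0 => (hw hw0).angular)⟩

theorem eventually_hodographSystem (h : ∀ᶠ w in 𝓝 q, IsHodographAt f X ε ρ k w) :
    ∀ᶠ w in 𝓝 q, HodographSystem ε k X w :=
  h.eventually_nhds.mono fun _ => hodographSystem

/-- The derivatives of the two equations of `HodographSystem` combine to the two components of the
wave equation, the radial one being multiplied by `k`. -/
theorem angularPart_wave_eq_zero_and (h : ∀ᶠ w in 𝓝 q, IsHodographAt f X ε ρ k w) :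
    angularPart q.1 (d₂ (d₂ X) q + ε • d₁ (d₁ X) q) = 0 ∧
      k q.2 * radialPart q.1 (d₂ (d₂ X) q + ε • d₁ (d₁ X) q) = 0 := by
  obtain ⟨hρ, hX, -, -, -⟩ := h.self_of_nhds
  have hsys := eventually_hodographSystem h
  obtain ⟨hrad, hang⟩ := hsys.self_of_nhds
  have hk := hρ.hasDerivAt_logDeriv
  have h₁₁ := hasDerivAt_d₁ (differentiableAt_d₁ hX)
  have h₁₂ := hasDerivAt_d₂ (differentiableAt_d₁ hX)
  have h₂₁ := hasDerivAt_d₁ (differentiableAt_d₂ hX)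
  have h₂₂ := hasDerivAt_d₂ (differentiableAt_d₂ hX)
  rw [d₂_d₁_comm hX] at h₁₂
  have hrad_s := ((hasDerivAt_angularPart_const (θ := q.1) h₂₂).add
    (hk.mul (hasDerivAt_radialPart_const (θ := q.1) h₁₂))).unique
    ((hasDerivAt_const q.2 (0 : ℝ)).congr_of_eventuallyEq
      ((eventually_nhds_snd hsys).mono fun s hs => hs.radial))
  have hrad_θ := ((hasDerivAt_angularPart h₂₁).add
    ((hasDerivAt_radialPart h₁₁).const_mul (k q.2))).unique
    ((hasDerivAt_const q.1 (0 : ℝ)).congr_of_eventuallyEq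
      ((eventually_nhds_fst hsys).mono fun t ht => ht.radial))
  have hang_s := ((hasDerivAt_angularPart_const (θ := q.1) h₁₂).sub
    ((hk.const_mul ε).mul (hasDerivAt_radialPart_const (θ := q.1) h₂₂))).unique
    ((hasDerivAt_const q.2 (0 : ℝ)).congr_of_eventuallyEq
      ((eventually_nhds_snd hsys).mono fun s hs => hs.angular))
  have hang_θ := ((hasDerivAt_angularPart h₁₁).sub
    ((hasDerivAt_radialPart h₂₁).const_mul (ε * k q.2))).unique
    ((hasDerivAt_const q.1 (0 : ℝ)).congr_of_eventuallyEq
      ((eventually_nhds_fst hsys).mono fun t ht => ht.angular))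
  simp only [Prod.mk.eta] at hrad_s hrad_θ hang_s hang_θ
  have hε := hρ.sq_eq_one
  simp only [radialPart_add_smul, angularPart_add_smul]
  constructor
  · linear_combination hrad_s + ε * hang_θ + k q.2 * hrad
      + k q.2 * (radialPart q.1 (d₁ (d₂ X) q) + angularPart q.1 (d₂ X q)) * hε
  · linear_combination ε * (hrad_θ - hang_s) - ε * k q.2 * hang
      - (ε * radialPart q.1 (d₂ X q) + k q.2 * radialPart q.1 (d₂ (d₂ X) q)) * hε

theorem isWaveSolutionAt_hodograph (h : ∀ᶠ w in 𝓝 q, IsHodographAt f X ε ρ k w) :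
    IsWaveSolutionAt ε X q := by
  have hX := h.self_of_nhds.contDiffAt
  have h₁ := contDiffAt_d₁ (m := 1) hX (by norm_num)
  have h₂ := contDiffAt_d₂ (m := 1) hX (by norm_num)
  refine ⟨hX, eq_zero_of_eventually_ne (G := fun w => d₂ (d₂ X) w + ε • d₁ (d₁ X) w)
    ((contDiffAt_d₂ (m := 0) h₂ (by norm_num)).continuousAt.add
      ((contDiffAt_d₁ (m := 0) h₁ (by norm_num)).continuousAt.const_smul ε)) ?_⟩
  filter_upwards [h.eventually_nhds] with w hw hw0
  obtain ⟨hang, hrad⟩ := angularPart_wave_eq_zero_and hw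
  exact eq_zero_of_radialPart_of_angularPart
    ((mul_eq_zero.1 hrad).resolve_left (hw.self_of_nhds.profile.logDeriv_ne_zero hw0)) hang

theorem fderiv_eq_mul_radialPart (h : IsHodographAt f X ε ρ k q) (w : ℝ × ℝ) :
    fderiv ℝ f (X q) w = ρ q.2 * radialPart q.1 w := by
  have h₁ : d₁ f (X q) = ρ q.2 * Real.cos q.1 := congrArg Prod.fst h.grad_eq
  have h₂ : d₂ f (X q) = ρ q.2 * Real.sin q.1 := congrArg Prod.snd h.grad_eq
  rw [fderiv_apply_eq_d₁_add_d₂, h₁, h₂, radialPart, smul_eq_mul, smul_eq_mul]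
  ring

theorem d₁_height (h : IsHodographAt f X ε ρ k q) :
    d₁ (fun w => f (X w)) q = ρ q.2 * radialPart q.1 (d₁ X q) := by
  rw [d₁_comp (h.contDiffAt_base.differentiableAt two_ne_zero)
    (h.contDiffAt.differentiableAt two_ne_zero), fderiv_eq_mul_radialPart h]

theorem d₂_height (h : IsHodographAt f X ε ρ k q) :
    d₂ (fun w => f (X w)) q = ρ q.2 * radialPart q.1 (d₂ X q) := by
  rw [d₂_comp (h.contDiffAt_base.differentiableAt two_ne_zero)
    (h.contDiffAt.differentiableAt two_ne_zero), fderiv_eq_mul_radialPart h]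

theorem isWaveSolutionAt_height (h : ∀ᶠ w in 𝓝 q, IsHodographAt f X ε ρ k w) :
    IsWaveSolutionAt ε (fun w => f (X w)) q := by
  obtain ⟨hρ, hX, hf, -, -⟩ := h.self_of_nhds
  have hT : ContDiffAt ℝ 2 (fun w => f (X w)) q := hf.comp q hX
  have h₁₁ := (hasDerivAt_d₁ (differentiableAt_d₁ hT)).unique
    (((hasDerivAt_radialPart (hasDerivAt_d₁ (differentiableAt_d₁ hX))).const_mul
      (ρ q.2)).congr_of_eventuallyEq ((eventually_nhds_fst h).mono fun t ht => d₁_height ht))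
  have h₂₂ := (hasDerivAt_d₂ (differentiableAt_d₂ hT)).unique
    ((hρ.hasDerivAt.mul (hasDerivAt_radialPart_const (θ := q.1)
      (hasDerivAt_d₂ (differentiableAt_d₂ hX)))).congr_of_eventuallyEq
      ((eventually_nhds_snd h).mono fun s hs => d₂_height hs))
  have hwave := congrArg (radialPart q.1) (isWaveSolutionAt_hodograph h).equation
  have hzero : radialPart q.1 0 = 0 := by simp [radialPart]
  rw [radialPart_add_smul, hzero] at hwave
  refine ⟨hT, ?_⟩
  rw [h₁₁, h₂₂, smul_eq_mul]
  linear_combination ρ q.2 * hwave + ε * ρ q.2 * (hodographSystem h).angular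
    + ρ q.2 * k q.2 * radialPart q.1 (d₂ X q) * hρ.sq_eq_one

theorem isWaveSolutionAt_graphPoint (h : ∀ᶠ w in 𝓝 q, IsHodographAt f X ε ρ k w) (j : Fin 3) :
    IsWaveSolutionAt ε (fun w => graphPoint f (X w) j) q :=
  match j with
  | 0 => isWaveSolutionAt_height h
  | 1 => (isWaveSolutionAt_hodograph h).clm_comp (.fst ℝ ℝ ℝ)
  | 2 => (isWaveSolutionAt_hodograph h).clm_comp (.snd ℝ ℝ ℝ)

theorem d₂_hodograph_eq_zero (h : ∀ᶠ w in 𝓝 q, IsHodographAt f X ε ρ k w) (hk : k q.2 = 0) :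
    d₂ X q = 0 := by
  obtain ⟨a, b, c, -, -, hx, -, hy⟩ := exists_frame_hessian_hodograph h
  have hang : angularPart q.1 (d₂ X q) = 0 := by simpa [hk] using (hodographSystem h).radial
  have hang' : angularPart q.1 (d₁ X q) = 0 := by simpa [hk] using (hodographSystem h).angular
  have hb : b ≠ 0 := by
    rintro rfl
    exact h.self_of_nhds.profile.ne_zero (by simpa [hang'] using hy.symm)
  exact eq_zero_of_radialPart_of_angularPart (by simpa [hang, hb] using hx) hang

theorem radialPart_d₁_hodograph_ne_zero (h : ∀ᶠ w in 𝓝 q, IsHodographAt f X ε ρ k w)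
    (hk : k q.2 = 0) : radialPart q.1 (d₁ X q) ≠ 0 := by
  obtain ⟨a, b, c, -, -, -, -, hy⟩ := exists_frame_hessian_hodograph h
  have hang : angularPart q.1 (d₁ X q) = 0 := by simpa [hk] using (hodographSystem h).angular
  exact fun h0 => h.self_of_nhds.profile.ne_zero (by simpa [hang, h0] using hy.symm)

theorem d₂_graphPoint_eq_zero (h : ∀ᶠ w in 𝓝 q, IsHodographAt f X ε ρ k w) (hk : k q.2 = 0)
    (j : Fin 3) : d₂ (fun w => graphPoint f (X w) j) q = 0 := by
  have hX := h.self_of_nhds.contDiffAt.differentiableAt two_ne_zero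
  have hX₂ := d₂_hodograph_eq_zero h hk
  match j with
  | 0 =>
    refine (d₂_height h.self_of_nhds).trans ?_
    simp [hX₂, radialPart]
  | 1 => exact (d₂_clm_comp (.fst ℝ ℝ ℝ) hX).trans (congrArg Prod.fst hX₂)
  | 2 => exact (d₂_clm_comp (.snd ℝ ℝ ℝ) hX).trans (congrArg Prod.snd hX₂)

/-- The null vector over the unit vector `(cos θ, sin θ)`. -/
noncomputable def nullDirection (θ : ℝ) : Mink := ![1, Real.cos θ, Real.sin θ]

theorem hasDerivAt_graphPoint (h : ∀ᶠ w in 𝓝 q, IsHodographAt f X ε ρ k w) (hρ : ρ q.2 = 1) :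
    HasDerivAt (fun t => graphPoint f (X (t, q.2)))
      (radialPart q.1 (d₁ X q) • nullDirection q.1) q.1 := by
  have hq := h.self_of_nhds
  have hX := hq.contDiffAt.differentiableAt two_ne_zero
  have hT : DifferentiableAt ℝ (fun w => f (X w)) q :=
    (isWaveSolutionAt_height h).contDiffAt.differentiableAt two_ne_zero
  have hang : angularPart q.1 (d₁ X q) = 0 := by
    simpa [hq.profile.logDeriv_eq_zero hρ] using (hodographSystem h).angular
  have hderiv : HasDerivAt (fun t => X (t, q.2)) (d₁ X q) q.1 := hasDerivAt_d₁ hX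
  rw [hasDerivAt_pi]
  intro j
  match j with
  | 0 => exact (hasDerivAt_d₁ hT).congr_deriv (by simp [d₁_height hq, hρ, nullDirection])
  | 1 =>
    refine HasDerivAt.congr_deriv (f' := (d₁ X q).1) hderiv.fst ?_
    simp [nullDirection, fst_eq_radialPart_sub_angularPart q.1 (d₁ X q), hang]
  | 2 =>
    refine HasDerivAt.congr_deriv (f' := (d₁ X q).2) hderiv.snd ?_
    simp [nullDirection, snd_eq_radialPart_add_angularPart q.1 (d₁ X q), hang]

end Hodograph

section DAlembert

variable {E : Type*} [NormedAddCommGroup E] [NormedSpace ℝ E]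

theorem eq_of_hasDerivAt_zero_on_ball {ψ : ℝ → E} {a r s : ℝ}
    (h : ∀ t ∈ Metric.ball a r, HasDerivAt ψ 0 t) (hs : s ∈ Metric.ball a r) : ψ s = ψ a :=
  Metric.isOpen_ball.is_const_of_deriv_eq_zero (convex_ball a r).isPreconnected
    (fun t ht => (h t ht).differentiableAt.differentiableWithinAt) (fun t ht => (h t ht).deriv) hs
    (Metric.mem_ball_self (Metric.pos_of_mem_ball hs))

variable {F : ℝ × ℝ → E} {u r : ℝ}

theorem mk_mem_ball_mk_zero {x y : ℝ} :
    (x, y) ∈ Metric.ball (u, (0 : ℝ)) r ↔ |x - u| < r ∧ |y| < r := by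
  simp [Prod.dist_eq, Real.dist_eq]

theorem d₁_add_smul_d₂_eq_of_wave {σ a b : ℝ} (hσ : σ ^ 2 = 1)
    (hF : ∀ q ∈ Metric.ball (u, (0 : ℝ)) r, IsWaveSolutionAt (-1) F q)
    (h0 : ∀ t ∈ Metric.ball u r, d₂ F (t, 0) = 0) (ha : |a - u| < r / 3) (hb : |b| < r / 3) :
    d₁ F (a, b) + σ • d₂ F (a, b) = d₁ F (a + σ * b, 0) := by
  have hbound (s : ℝ) (hs : |s| < r / 3) : |a + σ * (b - s) - u| < r := by
    rw [abs_lt] at *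
    rcases sq_eq_one_iff.1 hσ with rfl | rfl <;> constructor <;> linarith
  have hder : ∀ s ∈ Metric.ball 0 (r / 3), HasDerivAt (fun s =>
      d₁ F (a + σ * (b - s), s) + σ • d₂ F (a + σ * (b - s), s)) 0 s := by
    intro s hs
    rw [mem_ball_zero_iff, Real.norm_eq_abs] at hs
    obtain ⟨hc, hw⟩ := hF (a + σ * (b - s), s)
      (mk_mem_ball_mk_zero.2 ⟨hbound s hs, by linarith [abs_nonneg s]⟩)
    have hx : HasDerivAt (fun s : ℝ => a + σ * (b - s)) (-σ) s := by
      simpa using (((hasDerivAt_id s).const_sub b).const_mul σ).const_add a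
    refine ((hasDerivAt_comp_pair (differentiableAt_d₁ hc) hx (hasDerivAt_id s)).add
      ((hasDerivAt_comp_pair (differentiableAt_d₂ hc) hx
        (hasDerivAt_id s)).const_smul σ)).congr_deriv ?_
    rw [neg_one_smul, ← sub_eq_add_neg, sub_eq_zero] at hw
    have hσ' (w : E) : σ • σ • w = w := by rw [smul_smul, ← sq, hσ, one_smul]
    rw [id, d₂_d₁_comm hc, hw, one_smul, one_smul, smul_add, neg_smul, neg_smul, smul_neg, hσ']
    abel
  have h := eq_of_hasDerivAt_zero_on_ball hder (s := b)
    (by rwa [mem_ball_zero_iff, Real.norm_eq_abs])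
  have hb' : |a + σ * b - u| < r := by
    simpa using hbound 0 (by simpa using (abs_nonneg b).trans_lt hb)
  simpa [h0 _ (Metric.mem_ball.2 hb')] using h

theorem eventually_eq_average_of_wave
    (hF : ∀ᶠ q in 𝓝 ((u, 0) : ℝ × ℝ), IsWaveSolutionAt (-1) F q)
    (h0 : ∀ᶠ t in 𝓝 u, d₂ F (t, 0) = 0) :
    ∀ᶠ q in 𝓝 ((u, 0) : ℝ × ℝ),
      F q = (2⁻¹ : ℝ) • (F (q.1 + q.2, 0) + F (q.1 - q.2, 0)) := by
  obtain ⟨r, hr, hball⟩ := Metric.eventually_nhds_iff_ball.1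
    (hF.and ((continuous_fst.tendsto _).eventually h0))
  have hF (q) (hq : q ∈ Metric.ball (u, (0 : ℝ)) r) : IsWaveSolutionAt (-1) F q := (hball q hq).1
  have h0 (t) (ht : t ∈ Metric.ball u r) : d₂ F (t, 0) = 0 :=
    (hball (t, 0) (mk_mem_ball_mk_zero.2 ⟨ht, by simpa using hr⟩)).2
  filter_upwards [Metric.ball_mem_nhds (u, (0 : ℝ)) (show 0 < r / 3 by positivity)] with q hq
  obtain ⟨ha, hb⟩ := mk_mem_ball_mk_zero.1 hq
  have hdiff (x y : ℝ) (hx : |x - u| < r) (hy : |y| < r) : DifferentiableAt ℝ F (x, y) :=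
    (hF _ (mk_mem_ball_mk_zero.2 ⟨hx, hy⟩)).contDiffAt.differentiableAt two_ne_zero
  have hder : ∀ s ∈ Metric.ball 0 (r / 3), HasDerivAt (fun s =>
      F (q.1, s) - (2⁻¹ : ℝ) • (F (q.1 + s, 0) + F (q.1 - s, 0))) 0 s := by
    intro s hs
    rw [mem_ball_zero_iff, Real.norm_eq_abs] at hs
    have hplus := d₁_add_smul_d₂_eq_of_wave (one_pow 2) hF h0 ha hs
    have hminus := d₁_add_smul_d₂_eq_of_wave (σ := -1) (by norm_num) hF h0 ha hs
    rw [one_mul] at hplus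
    rw [neg_one_mul, ← sub_eq_add_neg] at hminus
    have hp : |q.1 + s - u| < r := by rw [abs_lt] at *; constructor <;> linarith
    have hm : |q.1 - s - u| < r := by rw [abs_lt] at *; constructor <;> linarith
    have h0r : |(0 : ℝ)| < r := by simpa using hr
    refine ((hasDerivAt_d₂ (hdiff q.1 s (by linarith) (by linarith))).sub
      (((hasDerivAt_comp_pair (hdiff _ 0 hp h0r) ((hasDerivAt_id s).const_add q.1)
        (hasDerivAt_const s (0 : ℝ))).add (hasDerivAt_comp_pair (hdiff _ 0 hm h0r)
        ((hasDerivAt_id s).const_sub q.1) (hasDerivAt_const s (0 : ℝ)))).const_smul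
          (2⁻¹ : ℝ))).congr_deriv ?_
    simp only [id, ← hplus, ← hminus]
    module
  have h := eq_of_hasDerivAt_zero_on_ball hder (s := q.2)
    (by rwa [mem_ball_zero_iff, Real.norm_eq_abs])
  rw [add_zero, sub_zero, ← two_smul ℝ (F (q.1, 0)), inv_smul_smul₀ two_ne_zero, sub_self] at h
  exact sub_eq_zero.1 h

end DAlembert

section Harmonic

variable {F : ℝ × ℝ → ℝ} {u : ℝ} {z : ℂ}

theorem fderiv_comp_equivRealProdCLM_one (F : ℝ × ℝ → ℝ) (z : ℂ) :
    fderiv ℝ (F ∘ equivRealProdCLM) z 1 = d₁ F (equivRealProdCLM z) := by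
  rw [ContinuousLinearEquiv.comp_right_fderiv]
  simp [d₁]

theorem fderiv_comp_equivRealProdCLM_I (F : ℝ × ℝ → ℝ) (z : ℂ) :
    fderiv ℝ (F ∘ equivRealProdCLM) z I = d₂ F (equivRealProdCLM z) := by
  rw [ContinuousLinearEquiv.comp_right_fderiv]
  simp [d₂]

open InnerProductSpace Laplacian in
theorem laplacian_comp_equivRealProdCLM (hF : ContDiffAt ℝ 2 F (equivRealProdCLM z)) :
    Δ (F ∘ equivRealProdCLM) z =
      d₂ (d₂ F) (equivRealProdCLM z) + d₁ (d₁ F) (equivRealProdCLM z) := by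
  have hcomp : ContDiffAt ℝ 2 (F ∘ equivRealProdCLM) z :=
    hF.comp z equivRealProdCLM.contDiff.contDiffAt
  have hd : DifferentiableAt ℝ (fderiv ℝ (F ∘ equivRealProdCLM)) z :=
    (hcomp.fderiv_right (m := 1) (by norm_num)).differentiableAt one_ne_zero
  have hsecond (v : ℂ) : fderiv ℝ (fderiv ℝ (F ∘ equivRealProdCLM)) z v v =
      fderiv ℝ (fun w => fderiv ℝ (F ∘ equivRealProdCLM) w v) z v := by
    rw [fderiv_clm_apply hd (differentiableAt_const v)]
    simp
  simp only [laplacian_eq_iteratedFDeriv_complexPlane, iteratedFDeriv_two_apply,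
    Matrix.cons_val_zero, Matrix.cons_val_one, hsecond, fderiv_comp_equivRealProdCLM_one,
    fderiv_comp_equivRealProdCLM_I]
  rw [add_comm]
  exact congrArg₂ (· + ·) (fderiv_comp_equivRealProdCLM_I (d₂ F) z)
    (fderiv_comp_equivRealProdCLM_one (d₁ F) z)

theorem harmonicAt_comp_equivRealProdCLM
    (hF : ∀ᶠ q in 𝓝 (equivRealProdCLM z), IsWaveSolutionAt 1 F q) :
    InnerProductSpace.HarmonicAt (F ∘ equivRealProdCLM) z := by
  refine ⟨hF.self_of_nhds.contDiffAt.comp z equivRealProdCLM.contDiff.contDiffAt, ?_⟩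
  filter_upwards [equivRealProdCLM.continuous.continuousAt.eventually hF] with w hw
  simpa [laplacian_comp_equivRealProdCLM hw.contDiffAt] using hw.equation

theorem tendsto_equivRealProdCLM_ofReal (u : ℝ) :
    Tendsto equivRealProdCLM (𝓝 (u : ℂ)) (𝓝 (u, 0)) :=
  Continuous.tendsto' equivRealProdCLM.continuous _ _ (by simp)

theorem im_deriv_eq_zero_of_d₂_eq_zero {C : ℂ → ℂ} (hC : DifferentiableAt ℂ C u)
    (hre : (fun z => (C z).re) =ᶠ[𝓝 (u : ℂ)] F ∘ equivRealProdCLM) (h0 : d₂ F (u, 0) = 0) :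
    (deriv C u).im = 0 := by
  have hreal := reCLM.hasFDerivAt.comp (u : ℂ) (hC.hasFDerivAt.restrictScalars ℝ)
  have hI := congrArg (· I) (hreal.fderiv.symm.trans hre.fderiv_eq)
  simpa [fderiv_comp_equivRealProdCLM_I, h0] using hI

theorem exists_analyticAt_re_eq_of_harmonic
    (hF : ∀ᶠ q in 𝓝 ((u, 0) : ℝ × ℝ), IsWaveSolutionAt 1 F q)
    (h0 : ∀ᶠ t in 𝓝 u, d₂ F (t, 0) = 0) :
    ∃ C : ℂ → ℂ, AnalyticAt ℂ C u ∧ (∀ᶠ t : ℝ in 𝓝 u, C t = F (t, 0)) ∧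
      ∀ᶠ z in 𝓝 (u : ℂ), (C z).re = F (equivRealProdCLM z) := by
  obtain ⟨R, hR, hball⟩ := Metric.eventually_nhds_iff_ball.1
    ((tendsto_equivRealProdCLM_ofReal u).eventually hF.eventually_nhds)
  obtain ⟨C, hC, hre⟩ := InnerProductSpace.HarmonicOnNhd.exists_analyticOnNhd_ball_re_eq
    fun z hz => harmonicAt_comp_equivRealProdCLM (hball z hz)
  have hCu : AnalyticAt ℂ C u := hC _ (Metric.mem_ball_self hR)
  have hre : (fun z => (C z).re) =ᶠ[𝓝 (u : ℂ)] F ∘ equivRealProdCLM :=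
    hre.eventuallyEq_of_mem (Metric.ball_mem_nhds _ hR)
  have hofReal : Tendsto ((↑) : ℝ → ℂ) (𝓝 u) (𝓝 u) := continuous_ofReal.tendsto u
  have him : ∀ᶠ t : ℝ in 𝓝 u, HasDerivAt (fun t : ℝ => (C t).im) 0 t := by
    filter_upwards [hofReal.eventually hCu.eventually_analyticAt,
      hofReal.eventually hre.eventuallyEq_nhds, h0] with t hCt hret h0t
    rw [← im_deriv_eq_zero_of_d₂_eq_zero hCt.differentiableAt hret h0t]
    exact imCLM.hasFDerivAt.comp_hasDerivAt t hCt.differentiableAt.hasDerivAt.comp_ofReal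
  obtain ⟨δ, hδ, him⟩ := Metric.eventually_nhds_iff_ball.1 him
  refine ⟨fun z => C z - (C u).im * I, hCu.sub analyticAt_const, ?_, ?_⟩
  · filter_upwards [Metric.ball_mem_nhds u hδ, hofReal.eventually hre] with t ht hret
    apply Complex.ext
    · simpa using hret
    · simpa [sub_eq_zero] using eq_of_hasDerivAt_zero_on_ball him ht
  · filter_upwards [hre] with z hz
    simpa using hz

end Harmonic

section NullDirection

theorem isLightlike_smul_nullDirection {c : ℝ} (hc : c ≠ 0) (θ : ℝ) :
    IsLightlike (c • nullDirection θ) := by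
  refine ⟨fun h => hc (by simpa [nullDirection] using congrFun h 0), ?_⟩
  simp only [lorentz, nullDirection, Pi.smul_apply, smul_eq_mul, Matrix.cons_val]
  linear_combination c ^ 2 * Real.sin_sq_add_cos_sq θ

theorem hasDerivAt_nullDirection (θ : ℝ) :
    HasDerivAt nullDirection ![0, -Real.sin θ, Real.cos θ] θ := by
  refine hasDerivAt_pi.2 fun j => ?_
  match j with
  | 0 => exact hasDerivAt_const θ 1
  | 1 => exact Real.hasDerivAt_cos θ
  | 2 => exact Real.hasDerivAt_sin θ

theorem IsNondegenerateNullCurve.of_hasDerivAt {I : Set ℝ} {γ : ℝ → Mink} {c : ℝ → ℝ}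
    (hI : IsOpen I) (hconn : I.OrdConnected) (hne : I.Nonempty) (hγ : AnalyticOnNhd ℝ γ I)
    (hderiv : ∀ t ∈ I, HasDerivAt γ (c t • nullDirection t) t) (hc : ∀ t ∈ I, c t ≠ 0) :
    IsNondegenerateNullCurve I γ := by
  refine ⟨hI, hconn, hne, hγ, fun t ht => ?_, fun t ht => ?_⟩
  · rw [(hderiv t ht).deriv]
    exact isLightlike_smul_nullDirection (hc t ht) t
  have hγ' : deriv γ =ᶠ[𝓝 t] fun s => c s • nullDirection s :=
    eventuallyEq_of_mem (hI.mem_nhds ht) fun s hs => (hderiv s hs).deriv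
  have hcdiff : DifferentiableAt ℝ c t := by
    have h0 : c =ᶠ[𝓝 t] fun s => deriv γ s 0 := by
      filter_upwards [hγ'] with s hs
      simp [hs, nullDirection]
    exact (differentiableAt_pi.1 (hγ t ht).deriv.differentiableAt 0).congr_of_eventuallyEq h0
  rintro ⟨κ, hκ⟩
  rw [hγ'.deriv_eq, (hcdiff.hasDerivAt.fun_smul (hasDerivAt_nullDirection t)).deriv,
    (hderiv t ht).deriv] at hκ
  have h₀ := congrFun hκ 0
  have h₁ := congrFun hκ 1
  have h₂ := congrFun hκ 2
  simp only [nullDirection, Pi.add_apply, Pi.smul_apply, smul_eq_mul, Matrix.cons_val] at h₀ h₁ h₂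
  apply hc t ht
  linear_combination -Real.sin t * (h₁ - Real.cos t * h₀) +
    Real.cos t * (h₂ - Real.sin t * h₀) - c t * Real.sin_sq_add_cos_sq t

end NullDirection

/-- `Z` is a `C²` local right inverse, near `w₀` and with values in `Ω`, of the gradient of `f`. -/
def IsLocalGradInverse (Ω : Set (ℝ × ℝ)) (f : ℝ × ℝ → ℝ) (Z : ℝ × ℝ → ℝ × ℝ) (w₀ : ℝ × ℝ) : Prop :=
  ∀ᶠ w in 𝓝 w₀, ContDiffAt ℝ 2 Z w ∧ Z w ∈ Ω ∧ grad f (Z w) = w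

/-- The graph of `f` parametrised through an inverse `Z` of the gradient, in polar coordinates of
the gradient plane with radial profile `ρ`. -/
noncomputable def hodographSurface (f : ℝ × ℝ → ℝ) (Z : ℝ × ℝ → ℝ × ℝ) (ρ : ℝ → ℝ) (q : ℝ × ℝ) :
    Mink :=
  graphPoint f (Z (polar ρ q))

/-- The curve over which the gradient of `f` has length one, parametrised by the angle of the
gradient; `Z` is an inverse of the gradient. -/
noncomputable def typeChangeCurve (f : ℝ × ℝ → ℝ) (Z : ℝ × ℝ → ℝ × ℝ) (t : ℝ) : Mink :=
  graphPoint f (Z (Real.cos t, Real.sin t))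

section Converse

variable {Ω : Set (ℝ × ℝ)} {f : ℝ × ℝ → ℝ} {Z : ℝ × ℝ → ℝ × ℝ} {θ ε : ℝ} {ρ k : ℝ → ℝ}

theorem IsZMCSolution.contDiffAt (hsol : IsZMCSolution Ω f) {z : ℝ × ℝ} (hz : z ∈ Ω) :
    ContDiffAt ℝ ∞ f z :=
  hsol.smooth.contDiffAt (hsol.isOpen.mem_nhds hz)

theorem IsZMCSolution.contDiffAt_two (hsol : IsZMCSolution Ω f) {z : ℝ × ℝ} (hz : z ∈ Ω) :
    ContDiffAt ℝ 2 f z :=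
  (hsol.contDiffAt hz).of_le (by norm_cast)

theorem exists_isLocalGradInverse (hsol : IsZMCSolution Ω f) {p : ℝ × ℝ} (hp : p ∈ Ω)
    (ht : IsNondegenerateTypeChange f p) :
    ∃ Z, Z (grad f p) = p ∧ IsLocalGradInverse Ω f Z (grad f p) := by
  obtain ⟨e, he, hsource, hsymm⟩ := exists_openPartialHomeomorph
    (contDiffAt_grad (m := 2) (hsol.contDiffAt hp) (by norm_cast)) two_ne_zero
    (ht.injective_fderiv_grad (hsol.contDiffAt_two hp) (hsol.equation p hp))
  have hback : e.symm (grad f p) = p := by rw [← he, e.left_inv hsource]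
  have htarget : grad f p ∈ e.target := by simpa only [he] using e.map_source hsource
  have hΩ : ∀ᶠ w in 𝓝 (grad f p), e.symm w ∈ Ω :=
    hsymm.continuousAt.eventually_mem (hsol.isOpen.mem_nhds (by rwa [hback]))
  refine ⟨e.symm, hback, ?_⟩
  filter_upwards [hsymm.eventually (by decide), e.open_target.mem_nhds htarget, hΩ]
    with w hw hwtarget hwΩ
  exact ⟨hw, hwΩ, by rw [← he, e.right_inv hwtarget]⟩

theorem exists_grad_eq_cos_sin {p : ℝ × ℝ} (hp : typeFun f p = 0) :
    ∃ θ : ℝ, grad f p = (Real.cos θ, Real.sin θ) := by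
  have hnorm : ‖(⟨d₁ f p, d₂ f p⟩ : ℂ)‖ = 1 := by
    rw [← sq_eq_sq₀ (norm_nonneg _) zero_le_one, Complex.sq_norm, normSq_mk]
    rw [typeFun] at hp
    linarith
  have hcos := norm_mul_cos_arg ⟨d₁ f p, d₂ f p⟩
  have hsin := norm_mul_sin_arg ⟨d₁ f p, d₂ f p⟩
  rw [hnorm, one_mul] at hcos hsin
  exact ⟨_, Prod.ext hcos.symm hsin.symm⟩

theorem eventually_isHodographAt (hsol : IsZMCSolution Ω f)
    (hZ : IsLocalGradInverse Ω f Z (Real.cos θ, Real.sin θ))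
    (hprofile : ∀ᶠ s in 𝓝 0, IsRadialProfile ε ρ k s) (hρ : ρ 0 = 1) :
    ∀ᶠ q in 𝓝 ((θ, 0) : ℝ × ℝ), IsHodographAt f (fun q => Z (polar ρ q)) ε ρ k q ∧
      hodographSurface f Z ρ q ∈ graphOver f Ω := by
  have hpolar : Tendsto (polar ρ) (𝓝 (θ, 0)) (𝓝 (Real.cos θ, Real.sin θ)) := by
    simpa [ContinuousAt, polar, hρ] using
      (contDiffAt_polar (q := (θ, 0)) hprofile.self_of_nhds.contDiffAt).continuousAt
  filter_upwards [hpolar.eventually hZ, (continuous_snd.tendsto (θ, (0 : ℝ))).eventually hprofile]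
    with q ⟨hsmooth, hΩ, hgrad⟩ hq
  exact ⟨⟨hq, hsmooth.comp q (contDiffAt_polar hq.contDiffAt), hsol.contDiffAt_two hΩ,
    hsol.equation _ hΩ, hgrad⟩, _, hΩ, rfl⟩

theorem eventually_isHodographAt_sech (hsol : IsZMCSolution Ω f)
    (hZ : IsLocalGradInverse Ω f Z (Real.cos θ, Real.sin θ)) :
    ∀ᶠ q in 𝓝 ((θ, 0) : ℝ × ℝ),
      IsHodographAt f (fun q => Z (polar sechProfile q)) 1 sechProfile Real.tanh q ∧
      hodographSurface f Z sechProfile q ∈ graphOver f Ω :=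
  eventually_isHodographAt hsol hZ (.of_forall isRadialProfile_sech) sechProfile_zero

theorem eventually_isHodographAt_sec (hsol : IsZMCSolution Ω f)
    (hZ : IsLocalGradInverse Ω f Z (Real.cos θ, Real.sin θ)) :
    ∀ᶠ q in 𝓝 ((θ, 0) : ℝ × ℝ),
      IsHodographAt f (fun q => Z (polar secProfile q)) (-1) secProfile (fun s => -Real.tan s) q ∧
      hodographSurface f Z secProfile q ∈ graphOver f Ω := by
  refine eventually_isHodographAt hsol hZ ?_ secProfile_zero
  filter_upwards [eventually_abs_sub_lt 0 (half_pos Real.pi_pos)] with s hs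
  exact isRadialProfile_sec (by simpa using hs)

theorem hodographSurface_mk_zero (f : ℝ × ℝ → ℝ) (Z : ℝ × ℝ → ℝ × ℝ) (hρ : ρ 0 = 1) (t : ℝ) :
    hodographSurface f Z ρ (t, 0) = typeChangeCurve f Z t := by
  simp [hodographSurface, typeChangeCurve, polar, hρ]

theorem hodographSurface_sech_neg (f : ℝ × ℝ → ℝ) (Z : ℝ × ℝ → ℝ × ℝ) (t s : ℝ) :
    hodographSurface f Z sechProfile (t, -s) = hodographSurface f Z sechProfile (t, s) := by
  simp [hodographSurface, polar, sechProfile]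

theorem eventually_isWaveSolutionAt_hodographSurface
    (h : ∀ᶠ q in 𝓝 ((θ, 0) : ℝ × ℝ), IsHodographAt f (fun q => Z (polar ρ q)) ε ρ k q ∧
      hodographSurface f Z ρ q ∈ graphOver f Ω) (j : Fin 3) :
    ∀ᶠ q in 𝓝 ((θ, 0) : ℝ × ℝ), IsWaveSolutionAt ε (fun w => hodographSurface f Z ρ w j) q :=
  h.eventually_nhds.mono fun _ hq => isWaveSolutionAt_graphPoint (hq.mono fun _ hw => hw.1) j

theorem eventually_d₂_hodographSurface_eq_zero
    (h : ∀ᶠ q in 𝓝 ((θ, 0) : ℝ × ℝ), IsHodographAt f (fun q => Z (polar ρ q)) ε ρ k q ∧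
      hodographSurface f Z ρ q ∈ graphOver f Ω) (hρ : ρ 0 = 1) (j : Fin 3) :
    ∀ᶠ t in 𝓝 θ, d₂ (fun w => hodographSurface f Z ρ w j) (t, 0) = 0 := by
  filter_upwards [eventually_nhds_fst h.eventually_nhds] with t ht
  exact d₂_graphPoint_eq_zero (ht.mono fun _ hw => hw.1)
    (ht.self_of_nhds.1.profile.logDeriv_eq_zero hρ) j

theorem exists_analyticAt_re_eq_hodographSurface (hsol : IsZMCSolution Ω f)
    (hZ : IsLocalGradInverse Ω f Z (Real.cos θ, Real.sin θ)) (j : Fin 3) :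
    ∃ C : ℂ → ℂ, AnalyticAt ℂ C θ ∧ (∀ᶠ t : ℝ in 𝓝 θ, C t = typeChangeCurve f Z t j) ∧
      ∀ᶠ z in 𝓝 (θ : ℂ), (C z).re = hodographSurface f Z sechProfile (equivRealProdCLM z) j := by
  have h := eventually_isHodographAt_sech hsol hZ
  obtain ⟨C, hC, hcurve, hre⟩ := exists_analyticAt_re_eq_of_harmonic
    (eventually_isWaveSolutionAt_hodographSurface h j)
    (eventually_d₂_hodographSurface_eq_zero h sechProfile_zero j)
  exact ⟨C, hC, by simpa only [hodographSurface_mk_zero f Z sechProfile_zero] using hcurve, hre⟩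

theorem eventually_hodographSurface_sec_eq (hsol : IsZMCSolution Ω f)
    (hZ : IsLocalGradInverse Ω f Z (Real.cos θ, Real.sin θ)) :
    ∀ᶠ q in 𝓝 ((θ, 0) : ℝ × ℝ), hodographSurface f Z secProfile q =
      (2⁻¹ : ℝ) • (typeChangeCurve f Z (q.1 + q.2) + typeChangeCurve f Z (q.1 - q.2)) := by
  have h := eventually_isHodographAt_sec hsol hZ
  have haverage (j : Fin 3) := eventually_eq_average_of_wave
    (eventually_isWaveSolutionAt_hodographSurface h j)
    (eventually_d₂_hodographSurface_eq_zero h secProfile_zero j)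
  simp only [hodographSurface_mk_zero f Z secProfile_zero] at haverage
  exact (eventually_all.2 haverage).mono fun q hq => funext hq

theorem analyticAt_typeChangeCurve (hsol : IsZMCSolution Ω f)
    (hZ : IsLocalGradInverse Ω f Z (Real.cos θ, Real.sin θ)) :
    AnalyticAt ℝ (typeChangeCurve f Z) θ := by
  refine analyticAt_pi_iff.2 fun j => ?_
  obtain ⟨C, hC, hcurve, -⟩ := exists_analyticAt_re_eq_hodographSurface hsol hZ j
  have hre : AnalyticAt ℝ (fun t : ℝ => (C t).re) θ :=
    (reCLM.analyticAt _).fun_comp ((hC.restrictScalars (𝕜 := ℝ)).fun_comp (ofRealCLM.analyticAt θ))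
  refine hre.congr ?_
  filter_upwards [hcurve] with t ht
  rw [ht, ofReal_re]

theorem exists_isNondegenerateNullCurve (hsol : IsZMCSolution Ω f)
    (hZ : IsLocalGradInverse Ω f Z (Real.cos θ, Real.sin θ)) :
    ∃ I, θ ∈ I ∧ IsNondegenerateNullCurve I (typeChangeCurve f Z) := by
  obtain ⟨δ, hδ, hball⟩ := Metric.eventually_nhds_iff_ball.1
    ((analyticAt_typeChangeCurve hsol hZ).eventually_analyticAt.and
      (eventually_nhds_fst (eventually_isHodographAt_sech hsol hZ).eventually_nhds))
  have hhodograph (t) (ht : t ∈ Metric.ball θ δ) := (hball t ht).2.mono fun _ hq => hq.1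
  refine ⟨Metric.ball θ δ, Metric.mem_ball_self hδ, .of_hasDerivAt
    (c := fun t => radialPart t (d₁ (fun q => Z (polar sechProfile q)) (t, 0)))
    Metric.isOpen_ball (convex_ball θ δ).ordConnected ⟨θ, Metric.mem_ball_self hδ⟩
    (fun t ht => (hball t ht).1) (fun t ht => ?_)
    fun t ht => radialPart_d₁_hodograph_ne_zero (hhodograph t ht) Real.tanh_zero⟩
  have hderiv := hasDerivAt_graphPoint (hhodograph t ht) sechProfile_zero
  exact hderiv.congr_of_eventuallyEq
    (.of_forall fun s => (hodographSurface_mk_zero f Z sechProfile_zero s).symm)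

variable {I : Set ℝ} {U : Set ℂ} {Γ : ℂ → Fin 3 → ℂ}

theorem eventually_re_eq_hodographSurface (hsol : IsZMCSolution Ω f)
    (hZ : IsLocalGradInverse Ω f Z (Real.cos θ, Real.sin θ)) (hI : IsOpen I) (hθ : θ ∈ I)
    (h : IsHolomorphicExtension I (typeChangeCurve f Z) U Γ) :
    ∀ᶠ z in 𝓝 (θ : ℂ), ∀ j,
      (Γ z j).re = hodographSurface f Z sechProfile (equivRealProdCLM z) j := by
  refine eventually_all.2 fun j => ?_
  obtain ⟨C, hC, hcurve, hre⟩ := exists_analyticAt_re_eq_hodographSurface hsol hZ j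
  have hCΓ : C =ᶠ[𝓝 (θ : ℂ)] fun z => Γ z j := by
    refine eventuallyEq_of_eventually_ofReal hC (analyticAt_pi_iff.1 (h.analyticAt hθ) j) ?_
    filter_upwards [hcurve, hI.mem_nhds hθ] with t ht htI
    rw [ht, h.agree t htI]
  filter_upwards [hCΓ, hre] with z hz hrez
  rw [← hz, hrez]

theorem eventually_phiHat_mem_graphOver_of_nonneg (hsol : IsZMCSolution Ω f)
    (hZ : IsLocalGradInverse Ω f Z (Real.cos θ, Real.sin θ)) (hI : IsOpen I) (hθ : θ ∈ I)
    (h : IsHolomorphicExtension I (typeChangeCurve f Z) U Γ) :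
    ∀ᶠ q in 𝓝 ((θ, 0) : ℝ × ℝ), 0 ≤ q.2 → phiHat Γ q ∈ graphOver f Ω := by
  have hre := eventually_re_eq_hodographSurface hsol hZ hI hθ h
  have hadd : Tendsto (fun q : ℝ × ℝ => (q.1 + Complex.I * (√q.2 : ℝ) : ℂ)) (𝓝 (θ, 0)) (𝓝 θ) :=
    Continuous.tendsto' (by fun_prop) _ _ (by simp)
  have hsub : Tendsto (fun q : ℝ × ℝ => (q.1 - Complex.I * (√q.2 : ℝ) : ℂ)) (𝓝 (θ, 0)) (𝓝 θ) :=
    Continuous.tendsto' (by fun_prop) _ _ (by simp)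
  have hsqrt : Tendsto (fun q : ℝ × ℝ => (q.1, √q.2)) (𝓝 (θ, 0)) (𝓝 (θ, 0)) :=
    Continuous.tendsto' (by fun_prop) _ _ (by simp)
  filter_upwards [hadd.eventually hre, hsub.eventually hre,
    hsqrt.eventually (eventually_isHodographAt_sech hsol hZ)] with q hadd hsub hgraph hq
  suffices phiHat Γ q = hodographSurface f Z sechProfile (q.1, √q.2) from this ▸ hgraph.2
  funext j
  have hhalf (z : ℂ) : (2⁻¹ * z).re = 2⁻¹ * z.re := by simp
  have haddj := hadd j
  have hsubj := hsub j
  simp only [equivRealProdCLM_apply, add_re, add_im, sub_re, sub_im, ofReal_re, ofReal_im,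
    I_mul_re, I_mul_im, neg_zero, add_zero, sub_zero, zero_add, zero_sub,
    hodographSurface_sech_neg] at haddj hsubj
  rw [phiHat, phiHatC, if_pos hq, Pi.smul_apply, smul_eq_mul, hhalf, Pi.add_apply, add_re, haddj,
    hsubj]
  ring

theorem eventually_phiHat_mem_graphOver_of_neg (hsol : IsZMCSolution Ω f)
    (hZ : IsLocalGradInverse Ω f Z (Real.cos θ, Real.sin θ)) (hI : IsOpen I) (hθ : θ ∈ I)
    (h : IsHolomorphicExtension I (typeChangeCurve f Z) U Γ) :
    ∀ᶠ q in 𝓝 ((θ, 0) : ℝ × ℝ), q.2 < 0 → phiHat Γ q ∈ graphOver f Ω := by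
  refine eventually_snd_neg_of_eventually_neg_sq ?_
  filter_upwards [(tendsto_fst_add_snd θ).eventually (hI.mem_nhds hθ),
    (tendsto_fst_sub_snd θ).eventually (hI.mem_nhds hθ),
    eventually_hodographSurface_sec_eq hsol hZ, eventually_isHodographAt_sec hsol hZ]
    with q hadd hsub hsec hgraph _
  rw [h.phiHat_neg_sq hadd hsub, ← hsec]
  exact hgraph.2

theorem exists_nullCurve_of_typeChange {p : ℝ × ℝ} (hsol : IsZMCSolution Ω f) (hp : p ∈ Ω)
    (ht : IsNondegenerateTypeChange f p) :
    ∃ (I : Set ℝ) (γ : ℝ → Mink) (u₀ : ℝ),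
      IsNondegenerateNullCurve I γ ∧ u₀ ∈ I ∧ γ u₀ = ![f p, p.1, p.2] ∧
      (∃ (U : Set ℂ) (Γ : ℂ → Fin 3 → ℂ), IsHolomorphicExtension I γ U Γ) ∧
      ∀ (U : Set ℂ) (Γ : ℂ → Fin 3 → ℂ), IsHolomorphicExtension I γ U Γ →
        ∃ (V Ω' : Set (ℝ × ℝ)), IsOpen V ∧ (u₀, (0 : ℝ)) ∈ V ∧
          V ⊆ phiHatDomain I U ∧ IsOpen Ω' ∧ p ∈ Ω' ∧ Ω' ⊆ Ω ∧
          (∀ q ∈ V, ∀ j, phiHatC Γ q j = (phiHat Γ q j : ℂ)) ∧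
          phiHat Γ '' V = graphOver f Ω' := by
  obtain ⟨θ, hθ⟩ := exists_grad_eq_cos_sin ht.1
  obtain ⟨Z, hZp, hZ⟩ := exists_isLocalGradInverse hsol hp ht
  rw [hθ] at hZp hZ
  obtain ⟨I, hθI, hγ⟩ := exists_isNondegenerateNullCurve hsol hZ
  have hγθ : typeChangeCurve f Z θ = ![f p, p.1, p.2] := by rw [typeChangeCurve, hZp, graphPoint]
  refine ⟨I, typeChangeCurve f Z, θ, hγ, hθI, hγθ, exists_holomorphicExtension hγ.analytic,
    fun U Γ hΓ => ?_⟩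
  have hregular := eventually_isRegularParameter hγ hΓ hθI
  obtain ⟨V, hVW, hV, hθV, r, -, hr, hproj, -⟩ := exists_graph_of_jac_ne_zero
    hregular.self_of_nhds.analyticAt hregular.self_of_nhds.jac_ne_zero
    (hregular.and ((eventually_phiHat_mem_graphOver_of_nonneg hsol hZ hγ.isOpen hθI hΓ).and
      (eventually_phiHat_mem_graphOver_of_neg hsol hZ hγ.isOpen hθI hΓ)))
  have hgraph (q) (hq : q ∈ V) : proj (phiHat Γ) q ∈ Ω ∧
      phiHat Γ q 0 = f (proj (phiHat Γ) q) := by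
    obtain ⟨-, hnonneg, hneg⟩ := hVW hq
    obtain ⟨z, hz, hφ⟩ := (le_or_gt 0 q.2).elim hnonneg hneg
    rw [proj, ← hφ]
    exact ⟨hz, rfl⟩
  have hp' : proj (phiHat Γ) (θ, 0) = p := by
    simp [proj, hΓ.phiHat_zero hθI, hγθ]
  refine ⟨V, Metric.ball p r, hV, hθV, fun q hq => (hVW hq).1.mem_domain, Metric.isOpen_ball,
    Metric.mem_ball_self hr, ?_, fun q hq => (hVW hq).1.ofReal_phiHat, ?_⟩
  · rw [← hp', ← hproj, Set.image_subset_iff]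
    exact fun q hq => (hgraph q hq).1
  · exact image_eq_graphOver (by rw [hproj, hp']) fun q hq => (hgraph q hq).2

end Converse

end TypeChange

theorem mainTheorem1 :
    -- the direct part
    (∀ (I : Set ℝ) (γ : ℝ → TypeChange.Mink), TypeChange.IsNondegenerateNullCurve I γ →
      (∃ (U : Set ℂ) (Γ : ℂ → Fin 3 → ℂ), TypeChange.IsHolomorphicExtension I γ U Γ) ∧
      ∀ (U : Set ℂ) (Γ : ℂ → Fin 3 → ℂ), TypeChange.IsHolomorphicExtension I γ U Γ →
        ∃ W : Set (ℝ × ℝ), IsOpen W ∧ (∀ u ∈ I, (u, (0 : ℝ)) ∈ W) ∧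
          W ⊆ TypeChange.phiHatDomain I U ∧
          (∀ q ∈ W, ∀ j, TypeChange.phiHatC Γ q j = (TypeChange.phiHat Γ q j : ℂ)) ∧
          TypeChange.IsAnalyticZMCImmersion W (TypeChange.phiHat Γ) ∧
          ∀ u ∈ I, TypeChange.phiHat Γ (u, 0) = γ u ∧
            TypeChange.IsNondegenerateTypeChangeOfSurface W (TypeChange.phiHat Γ) (u, 0)) ∧
    -- the converse
    (∀ (Ω : Set (ℝ × ℝ)) (f : ℝ × ℝ → ℝ) (p : ℝ × ℝ), TypeChange.IsZMCSolution Ω f → p ∈ Ω →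
      TypeChange.IsNondegenerateTypeChange f p →
      ∃ (I : Set ℝ) (γ : ℝ → TypeChange.Mink) (u₀ : ℝ),
        TypeChange.IsNondegenerateNullCurve I γ ∧ u₀ ∈ I ∧ γ u₀ = ![f p, p.1, p.2] ∧
        (∃ (U : Set ℂ) (Γ : ℂ → Fin 3 → ℂ), TypeChange.IsHolomorphicExtension I γ U Γ) ∧
        ∀ (U : Set ℂ) (Γ : ℂ → Fin 3 → ℂ), TypeChange.IsHolomorphicExtension I γ U Γ →
          ∃ (V Ω' : Set (ℝ × ℝ)), IsOpen V ∧ (u₀, (0 : ℝ)) ∈ V ∧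
            V ⊆ TypeChange.phiHatDomain I U ∧ IsOpen Ω' ∧ p ∈ Ω' ∧ Ω' ⊆ Ω ∧
            (∀ q ∈ V, ∀ j, TypeChange.phiHatC Γ q j = (TypeChange.phiHat Γ q j : ℂ)) ∧
            TypeChange.phiHat Γ '' V = TypeChange.graphOver f Ω') := by
  exact ⟨fun I γ hγ => ⟨TypeChange.exists_holomorphicExtension hγ.analytic,
      fun U Γ hΓ => TypeChange.exists_analyticZMCImmersion hγ hΓ⟩,
    fun Ω f p hsol hp ht => TypeChange.exists_nullCurve_of_typeChange hsol hp ht⟩
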